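/- Work in a monster model $M$ of an arbitrary first-order theory: for some uncountable cardinal $\theta$ larger than the number of symbols of the language, $M$ is $\theta$-saturated and strongly $\theta$-homogeneous; "small" means of cardinality less than $\theta$. Parameter sets and the cardinals $\kappa,\mu$ below are small, variables $x,y$ stand for finite tuples, and a set of formulas with parameters in $M$ is consistent if it is finitely satisfiable in $M$. Sequences are indexed by infinite linear orders and consist of finite tuples of a fixed length; a family of sequences is mutually indiscernible over $A$ if each of them is indiscernible over $A$ together with all elements of the others. For a consistent partial type $p(x)$ over a set $A$: * $\operatorname{dp-rank}(p)\le\mu$ (computed over $A$) means that for every realization $c$ of $p$ and every $1+\mu$ infinite mutually $A$-indiscernible sequences, at least one of them is indiscernible over $Ac$. Further, $\operatorname{dp-rank}(p)=\mu$ means that $\operatorname{dp-rank}(p)\le\mu$ and not $\operatorname{dp-rank}(p)\le\lambda$ for any $\lambda<\mu$. * A randomness pattern of depth $\kappa$ for $p$ over $A$ consists of sequences $I^\alpha=\langle b^\alpha_i : i<\omega\rangle$ and formulas $\phi_\alpha(x,y_\alpha)$ for $\alpha<\kappa$, with $|b^\alpha_i|=|y_\alpha|$, such that the $I^\alpha$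 are mutually indiscernible over $A$ and for every $\eta\in{}^{\kappa}\omega$ the set $\{\phi_\alpha(x,b^\alpha_{\eta(\alpha)}) : \alpha<\kappa\}\cup\{\neg\phi_\alpha(x,b^\alpha_i) : \alpha<\kappa,\ i\ne\eta(\alpha)\}$ is consistent with $p$. * An element $c$ splits a sequence over $A$ if two members of the sequence have different types over $Ac$. **Proposition.** Let $p(x)$ be a complete type over $A$, and let $\kappa$ be a cardinal, finite or infinite. The following are equivalent: 1. there is a randomness pattern of depth $1+\kappa$ for $p$ over $A$; 2. it is not the case that $\operatorname{dp-rank}(p)\le\kappa$; 3. there are $1+\kappa$ infinite mutually $A$-indiscernible sequences (indexed by a common linear order) and a realization $c$ of $p$ which splits each of them over $A$. In particular, if $\kappa$ is infinite, the same three conditions with $\kappa$ in place of $1+\kappa$ are equivalent. Moreover, for every $\kappa$, finite or infinite, there is a randomness pattern of depth $\kappa$ for $p$ over $A$ if and only if there are $\kappa$ sequences and a realization $c$ of $p$ as in (3). Consequently, the dp-rank does not depend on the base set: if $p$ is a consistent partial type over $A$ and also over $B$, then for every $\mu$, $\operatorname{dp-rank}(p)\le\mu$ computed over $A$ if and only if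 $\operatorname{dp-rank}(p)\le\mu$ computed over $B$, and likewise for $\operatorname{dp-rank}(p)=\mu$. -/

import Mathlib

open scoped FirstOrder Cardinal

universe u v w

namespace DpRank

variable {L : FirstOrder.Language.{u, v}} {M : Type w} [L.Structure M]

/-- `φ` is an `L(A)`-formula. Formulas with parameters from `M` in the variables `β` are the
`L`-formulas `φ : L.Formula (M ⊕ β)`, where an element of `M` stands for itself; those over `A`
mention no element of `M` outside `A`. -/
def FormulaOver {β : Type*} (A : Set M) (φ : L.Formula (M ⊕ β)) : Prop :=
  φ ∈ Set.range (FirstOrder.Language.Formula.relabel (Sum.map (Subtype.val : A → M) id) :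
    L.Formula (A ⊕ β) → L.Formula (M ⊕ β))

/-- `M ⊨ φ(c)`, for a formula `φ` with parameters from `M`. -/
def Sat {β : Type*} (φ : L.Formula (M ⊕ β)) (c : β → M) : Prop :=
  φ.Realize (Sum.elim id c)

/-- The formula `φ(x, b)` obtained from `φ(x, y)` by plugging in the tuple `b` for `y`. -/
def plug {β γ : Type*} (φ : L.Formula (β ⊕ γ)) (b : γ → M) : L.Formula (M ⊕ β) :=
  φ.relabel (Sum.elim Sum.inr (fun i => Sum.inl (b i)))

/-- `c` realizes the set of formulas `Γ`. -/
def Realizes {β : Type*} (Γ : Set (L.Formula (M ⊕ β))) (c : β → M) : Prop :=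
  ∀ φ ∈ Γ, Sat φ c

/-- `Γ` is consistent (with the elementary diagram of `M`), that is, finitely satisfiable
in `M`. -/
def Consistent {β : Type*} (Γ : Set (L.Formula (M ⊕ β))) : Prop :=
  ∀ Δ : Set (L.Formula (M ⊕ β)), Δ ⊆ Γ → Δ.Finite → ∃ c : β → M, Realizes Δ c

/-- `p` is a (consistent) partial type over `A`. -/
structure IsPartialType {β : Type*} (A : Set M) (p : Set (L.Formula (M ⊕ β))) : Prop where
  formulaOver : ∀ φ ∈ p, FormulaOver A φ
  consistent : Consistent p

/-- `p` is a complete type over `A`. -/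
structure IsCompleteType {β : Type*} (A : Set M) (p : Set (L.Formula (M ⊕ β))) : Prop
    extends IsPartialType A p where
  complete : ∀ φ : L.Formula (M ⊕ β), FormulaOver A φ → φ ∈ p ∨ ∼φ ∈ p

variable (L) in
/-- The complete type `tp(c / A)`. -/
def tp {β : Type*} (A : Set M) (c : β → M) : Set (L.Formula (M ⊕ β)) :=
  {φ | FormulaOver A φ ∧ Sat φ c}

variable (L M) in
/-- `M` is a monster model, "small" meaning "of cardinality less than `θ`": `M` is
`θ`-saturated and strongly `θ`-homogeneous, with `θ` uncountable and larger than the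
number of symbols of the language. -/
structure IsMonster (θ : Cardinal.{w}) : Prop where
  aleph0_lt : ℵ₀ < θ
  card_lt : Cardinal.lift.{w} L.card < Cardinal.lift.{max u v} θ
  saturated : ∀ A : Set M, #A < θ → ∀ (n : ℕ) (p : Set (L.Formula (M ⊕ Fin n))),
    IsPartialType A p → ∃ c : Fin n → M, Realizes p c
  homogeneous : ∀ A : Set M, #A < θ → ∀ f : A → M,
    (∀ φ : L.Formula A, φ.Realize (Subtype.val : A → M) ↔ φ.Realize f) →
      ∃ σ : M ≃[L] M, ∀ a : A, σ a = f a

variable (L) in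
/-- The sequence `(a i)` of `n`-tuples, indexed by a linear order, is indiscernible over `A`:
any two increasing finite subsequences of the same length have the same type over `A`. -/
def IndiscernibleOver {I : Type*} [LinearOrder I] {n : ℕ} (A : Set M)
    (a : I → Fin n → M) : Prop :=
  ∀ (k : ℕ) (s t : Fin k ↪o I),
    tp L A (fun q : Fin k × Fin n => a (s q.1) q.2) =
      tp L A (fun q : Fin k × Fin n => a (t q.1) q.2)

variable (L) in
/-- The sequences `a j`, for `j : J`, are mutually indiscernible over `A`: each of them is
indiscernible over `A` together with all elements of the other sequences. -/
def MutuallyIndiscernible {J : Type*} {I : J → Type*} [∀ j, LinearOrder (I j)] {n : J → ℕ}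
    (A : Set M) (a : ∀ j, I j → Fin (n j) → M) : Prop :=
  ∀ j, IndiscernibleOver L
    (A ∪ {x | ∃ j', j' ≠ j ∧ ∃ (i : I j') (l : Fin (n j')), a j' i l = x}) (a j)

/-- `dp-rank(p) ≤ μ`, computed over `A`: for every realization `c` of `p` and every `1 + μ`
infinite mutually `A`-indiscernible sequences, one of these is indiscernible over `Ac`. -/
def DpRankLE {m : ℕ} (A : Set M) (p : Set (L.Formula (M ⊕ Fin m))) (μ : Cardinal.{w}) : Prop :=
  ∀ c : Fin m → M, Realizes p c →
    ∀ J : Type w, #J = 1 + μ →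
      ∀ (I : J → Type w) [∀ j, LinearOrder (I j)] [∀ j, Infinite (I j)] (n : J → ℕ)
        (a : ∀ j, I j → Fin (n j) → M),
        MutuallyIndiscernible L A a →
          ∃ j, IndiscernibleOver L (A ∪ Set.range c) (a j)

/-- `dp-rank(p) = μ`, computed over `A`. -/
def HasDpRank {m : ℕ} (A : Set M) (p : Set (L.Formula (M ⊕ Fin m))) (μ : Cardinal.{w}) : Prop :=
  DpRankLE A p μ ∧ ∀ ν < μ, ¬ DpRankLE A p ν

/-- There is a randomness pattern of depth `κ` for `p(x)` over `A`: there are sequences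
`(b α i)_{i < ω}` and formulas `φ α (x, y_α)`, for `κ` many `α`, such that the sequences are
mutually indiscernible over `A` and, for every `η`, the set of all `φ α (x, b α (η α))` and
all `¬ φ α (x, b α i)` with `i ≠ η α` is consistent with `p`. -/
def HasRandomnessPattern {m : ℕ} (A : Set M) (p : Set (L.Formula (M ⊕ Fin m)))
    (κ : Cardinal.{w}) : Prop :=
  ∃ (J : Type w) (n : J → ℕ) (b : ∀ α : J, ℕ → Fin (n α) → M)
    (φ : ∀ α : J, L.Formula (Fin m ⊕ Fin (n α))),
    #J = κ ∧ MutuallyIndiscernible L A b ∧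
      ∀ η : J → ℕ, Consistent
        (p ∪ {ψ | ∃ α, ψ = plug (φ α) (b α (η α))} ∪
          {ψ | ∃ α i, i ≠ η α ∧ ψ = ∼(plug (φ α) (b α i))})

/-- There are `κ` infinite mutually `A`-indiscernible sequences (indexed by a common linear
order) and a realization `c` of `p` that splits each of them: each sequence has two members
with different types over `Ac`. -/
def HasSplitSequences {m : ℕ} (A : Set M) (p : Set (L.Formula (M ⊕ Fin m)))
    (κ : Cardinal.{w}) : Prop :=
  ∃ (J I : Type w) (_ : LinearOrder I) (n : J → ℕ) (a : ∀ j : J, I → Fin (n j) → M)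
    (c : Fin m → M),
    #J = κ ∧ Infinite I ∧ MutuallyIndiscernible L A a ∧ Realizes p c ∧
      ∀ j, ∃ i₁ i₂ : I,
        tp L (A ∪ Set.range c) (a j i₁) ≠ tp L (A ∪ Set.range c) (a j i₂)

end DpRank

-- Suppose that `c` realizes `p` and that none of the given mutually indiscernible sequences stays
-- indiscernible over `Ac`. Each sequence then has a set definable over `A` which, with `c` plugged
-- in, contains one increasing tuple of the sequence and omits another of the same length. The tool
-- for exploiting this is copying (`IsMonster.exists_realizes_of_orderEquivalent`): truth values
-- that some realization of `p` takes along blocks of the sequences are taken by another realization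
-- along any blocks of the same order type, in all sequences at once.
--
-- Cut each sequence into consecutive blocks. Pigeonhole and copying give a truth value `v` such
-- that, for any prescribed position, some realization takes the value `¬v` there and `v` at all
-- later blocks (`MutuallyIndiscernible.exists_truth_values`). A second pigeonhole makes the values
-- before that position constant. Group the blocks in pairs, with the prescribed position at the
-- start of a pair: the values `¬v`, `v` then occur in that pair alone. The formula saying so,
-- evaluated at the pairs, is a randomness pattern
-- (`hasRandomnessPattern_of_not_indiscernibleOver`). Conversely, realizing a pattern for one `η`
-- splits every sequence, and a split sequence is not indiscernible over `Ac`.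
--
-- The rank is independent of the base because patterns are (`HasRandomnessPattern.change_base`).
-- The consistency conditions of a pattern do not see the order of the sequences, so the tuples may
-- be replaced by successive limits along a nonprincipal ultrafilter. Such limits are mutually
-- indiscernible over any small base, and their finite behaviour is reflected by the original
-- tuples.

namespace DpRank

open FirstOrder Language

-- Definable sets in possibly infinitely many variables

section Definable

variable {L : FirstOrder.Language.{u, v}} {M : Type w} [L.Structure M]

variable (L) in
/-- `X` is the set of solutions in `M` of some `L(A)`-formula. -/
def DefinableOver {β : Type*} (A : Set M) (X : Set (β → M)) : Prop :=
  ∃ φ : L.Formula (A ⊕ β), ∀ c, c ∈ X ↔ φ.Realize (Sum.elim Subtype.val c)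

namespace DefinableOver

variable {β γ δ ι : Type*} {A B : Set M} {X Y : Set (β → M)}

lemma compl (h : DefinableOver L A X) : DefinableOver L A Xᶜ := by
  obtain ⟨φ, hφ⟩ := h
  exact ⟨∼φ, fun c => by rw [Formula.realize_not, ← hφ]; rfl⟩

lemma univ : DefinableOver L A (Set.univ : Set (β → M)) :=
  ⟨⊤, fun c => by simp [Formula.Realize]⟩

lemma inter (h : DefinableOver L A X) (h' : DefinableOver L A Y) :
    DefinableOver L A (X ∩ Y) := by
  obtain ⟨φ, hφ⟩ := h
  obtain ⟨ψ, hψ⟩ := h'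
  exact ⟨φ ⊓ ψ, fun c => by rw [Formula.realize_inf, ← hφ, ← hψ]; rfl⟩

lemma biInter (T : Finset ι) {X : ι → Set (β → M)} (h : ∀ i ∈ T, DefinableOver L A (X i)) :
    DefinableOver L A (⋂ i ∈ T, X i) := by
  classical
  induction T using Finset.induction_on with
  | empty => simpa using univ
  | insert a s _ ih =>
    rw [Finset.set_biInter_insert]
    exact (h a (by simp)).inter (ih fun i hi => h i (by simp [hi]))

/-- Substituting variables and parameters for the variables of a definable set. -/
lemma preimage_subst (h : DefinableOver L A X) (g : β → A ⊕ γ) :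
    DefinableOver L A {c : γ → M | (fun i => Sum.elim Subtype.val c (g i)) ∈ X} := by
  obtain ⟨φ, hφ⟩ := h
  refine ⟨φ.relabel (Sum.elim Sum.inl g), fun c => ?_⟩
  rw [Formula.realize_relabel]
  refine (hφ _).trans (iff_of_eq ?_)
  congr 1
  ext (i | i) <;> rfl

lemma mono (hAB : A ⊆ B) (h : DefinableOver L A X) : DefinableOver L B X := by
  obtain ⟨φ, hφ⟩ := h
  refine ⟨φ.relabel (Sum.map (Set.inclusion hAB) id), fun c => ?_⟩
  rw [Formula.realize_relabel]
  refine (hφ _).trans (iff_of_eq ?_)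
  congr 1
  ext (i | i) <;> rfl

/-- Each variable is replaced by a variable or by an element of `B`. -/
lemma preimage (h : DefinableOver L A X) (hAB : A ⊆ B) (f : (γ → M) → β → M)
    (hf : ∀ i, (∃ b ∈ B, ∀ c, f c i = b) ∨ ∃ j, ∀ c, f c i = c j) :
    DefinableOver L B {c | f c ∈ X} := by
  classical
  choose g hg using fun i => show ∃ g : B ⊕ γ, ∀ c, f c i = Sum.elim Subtype.val c g by
    rcases hf i with ⟨b, hb, h⟩ | ⟨j, h⟩
    · exact ⟨Sum.inl ⟨b, hb⟩, h⟩
    · exact ⟨Sum.inr j, h⟩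
  convert (h.mono hAB).preimage_subst g using 3 with c
  exact iff_of_eq (congrArg (· ∈ X) (funext fun i => hg i c))

lemma comp (h : DefinableOver L A X) (f : β → γ) :
    DefinableOver L A {c : γ → M | (fun i => c (f i)) ∈ X} :=
  h.preimage subset_rfl _ fun i => Or.inr ⟨f i, fun _ => rfl⟩

/-- The parameters from `B` can be turned into variables. -/
lemma exists_union (h : DefinableOver L (A ∪ B) X) :
    ∃ Y : Set (B ⊕ β → M), DefinableOver L A Y ∧ ∀ c, c ∈ X ↔ Sum.elim Subtype.val c ∈ Y := by
  classical
  obtain ⟨φ, hφ⟩ := h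
  let g : (A ∪ B : Set M) ⊕ β → A ⊕ (B ⊕ β) := Sum.elim
    (fun x => if h : x.1 ∈ A then Sum.inl ⟨x.1, h⟩ else
      Sum.inr (Sum.inl ⟨x.1, x.2.resolve_left h⟩)) (fun i => Sum.inr (Sum.inr i))
  refine ⟨{c | (φ.relabel g).Realize (Sum.elim Subtype.val c)}, ⟨_, fun _ => Iff.rfl⟩,
    fun c => ?_⟩
  refine (hφ _).trans ?_
  change _ ↔ (φ.relabel g).Realize _
  rw [Formula.realize_relabel]
  refine iff_of_eq ?_
  congr 1
  ext (i | i)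
  · by_cases h : i.1 ∈ A <;> simp [g, h]
  · rfl

lemma exists_support (h : DefinableOver L A X) :
    ∃ T : Finset β, ∀ c c', (∀ i ∈ T, c i = c' i) → (c ∈ X ↔ c' ∈ X) := by
  classical
  obtain ⟨φ, hφ⟩ := h
  refine ⟨φ.freeVarFinset.toRight, fun c c' hc => ?_⟩
  rw [hφ, hφ]
  have key : ∀ d : β → M, φ.Realize (Sum.elim Subtype.val d) ↔
      Formula.Realize (φ.restrictFreeVar id : L.Formula φ.freeVarFinset)
        (fun i => (Sum.elim Subtype.val d i.1 : M)) := fun d =>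
    (BoundedFormula.realize_restrictFreeVar (φ := φ) (f := id)
      (v := fun i : φ.freeVarFinset => (Sum.elim Subtype.val d i.1 : M)) _ (fun _ => rfl)).symm
  rw [key, key]
  refine iff_of_eq (congrArg _ ?_)
  ext ⟨i | i, hi⟩
  · rfl
  · exact hc i (by simpa using hi)

/-- A definable set is defined by an `L`-formula and a finite tuple of parameters. -/
lemma exists_finite_parameters (h : DefinableOver L A X) :
    ∃ (P : Type w) (_ : Finite P) (d : P → A) (φ : L.Formula (P ⊕ β)),
      ∀ c, c ∈ X ↔ φ.Realize (Sum.elim (fun i => (d i : M)) c) := by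
  classical
  obtain ⟨φ, hφ⟩ := h
  let g : φ.freeVarFinset → (φ.freeVarFinset.toLeft : Set A) ⊕ β := fun i =>
    match i with
    | ⟨Sum.inl a, h⟩ => Sum.inl ⟨a, by simpa using h⟩
    | ⟨Sum.inr b, _⟩ => Sum.inr b
  refine ⟨(φ.freeVarFinset.toLeft : Set A), Finset.finite_toSet _, Subtype.val,
    φ.restrictFreeVar g, fun c => ?_⟩
  refine (hφ _).trans ?_
  refine (BoundedFormula.realize_restrictFreeVar (φ := φ) (f := g)
    (Sum.elim Subtype.val c) ?_).symm
  rintro ⟨a | b, h⟩ <;> rfl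

/-- A formula mentions finitely many variables, so quantifying over an infinite tuple amounts to a
first-order quantifier over a finite one. -/
lemma image_inl [Nonempty M] {X : Set (γ ⊕ δ → M)} (h : DefinableOver L A X) :
    DefinableOver L A {c : γ → M | ∃ d : δ → M, Sum.elim c d ∈ X} := by
  classical
  obtain ⟨φ, hφ⟩ := h
  let g : φ.freeVarFinset → (A ⊕ γ) ⊕ (φ.freeVarFinset) := fun i =>
    match i with
    | ⟨Sum.inl a, _⟩ => Sum.inl (Sum.inl a)
    | ⟨Sum.inr (Sum.inl b), _⟩ => Sum.inl (Sum.inr b)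
    | ⟨Sum.inr (Sum.inr b), h⟩ => Sum.inr ⟨_, h⟩
  refine ⟨Formula.iExs φ.freeVarFinset (φ.restrictFreeVar g), fun c => ?_⟩
  rw [Formula.realize_iExs]
  obtain ⟨m₀⟩ := ‹Nonempty M›
  constructor
  · rintro ⟨d, hd⟩
    rw [hφ] at hd
    refine ⟨fun i => Sum.elim Subtype.val (Sum.elim c d) i.1, ?_⟩
    refine (BoundedFormula.realize_restrictFreeVar (φ := φ) (f := g)
      (Sum.elim Subtype.val (Sum.elim c d)) ?_).2 hd
    rintro ⟨a | b | b, h⟩ <;> rfl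
  · rintro ⟨i, hi⟩
    -- Variables that do not occur in `φ` get the default value `m₀`.
    let d : δ → M := fun b => if h : Sum.inr (Sum.inr b) ∈ φ.freeVarFinset then i ⟨_, h⟩ else m₀
    refine ⟨d, (hφ _).2 ?_⟩
    refine (BoundedFormula.realize_restrictFreeVar (φ := φ) (f := g)
      (Sum.elim Subtype.val (Sum.elim c d)) ?_).1 hi
    rintro ⟨a | b | b, h⟩
    · rfl
    · rfl
    · simp [g, d, h]

end DefinableOver

lemma FormulaOver.definableOver {β : Type*} {A : Set M} {φ : L.Formula (M ⊕ β)}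
    (h : FormulaOver A φ) : DefinableOver L A {c | Sat φ c} := by
  obtain ⟨ψ, rfl⟩ := h
  refine ⟨ψ, fun c => ?_⟩
  change Formula.Realize _ _ ↔ _
  rw [Formula.realize_relabel]
  refine iff_of_eq ?_
  congr 1
  ext (i | i) <;> rfl

lemma DefinableOver.exists_formulaOver {β : Type*} {A : Set M} {X : Set (β → M)}
    (h : DefinableOver L A X) :
    ∃ φ : L.Formula (M ⊕ β), FormulaOver A φ ∧ ∀ c, c ∈ X ↔ Sat φ c := by
  obtain ⟨ψ, hψ⟩ := h
  refine ⟨_, ⟨ψ, rfl⟩, fun c => (hψ c).trans ?_⟩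
  rw [Sat, Formula.realize_relabel]
  refine iff_of_eq ?_
  congr 1
  ext (i | i) <;> rfl

lemma tp_eq_iff {β : Type*} {A : Set M} {c d : β → M} :
    tp L A c = tp L A d ↔ ∀ X, DefinableOver L A X → (c ∈ X ↔ d ∈ X) := by
  constructor
  · intro h X hX
    obtain ⟨φ, hφ, hX⟩ := hX.exists_formulaOver
    rw [hX, hX]
    have := Set.ext_iff.1 h φ
    exact ⟨fun hc => (this.1 ⟨hφ, hc⟩).2, fun hc => (this.2 ⟨hφ, hc⟩).2⟩
  · intro h
    ext φ
    exact and_congr_right fun hφ => h _ hφ.definableOver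

lemma sat_not {β : Type*} {φ : L.Formula (M ⊕ β)} {c : β → M} : Sat (∼φ) c ↔ ¬ Sat φ c :=
  Formula.realize_not

lemma sat_plug {β γ : Type*} {φ : L.Formula (β ⊕ γ)} {b : γ → M} {c : β → M} :
    Sat (plug φ b) c ↔ φ.Realize (Sum.elim c b) := by
  rw [Sat, plug, Formula.realize_relabel]
  refine iff_of_eq ?_
  congr 1
  ext (i | i) <;> rfl

lemma definableOver_realize {β : Type*} (A : Set M) (φ : L.Formula β) :
    DefinableOver L A {c : β → M | φ.Realize c} := by
  refine ⟨φ.relabel Sum.inr, fun c => ?_⟩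
  rw [Formula.realize_relabel]
  rfl

lemma DefinableOver.fiber {β γ : Type*} {A B : Set M} {X : Set (β ⊕ γ → M)}
    (h : DefinableOver L A X) (hAB : A ⊆ B) {b : γ → M} (hb : ∀ i, b i ∈ B) :
    DefinableOver L B {c : β → M | Sum.elim c b ∈ X} :=
  h.preimage hAB (fun c => Sum.elim c b) <| by
    rintro (i | i)
    · exact Or.inr ⟨i, fun _ => rfl⟩
    · exact Or.inl ⟨b i, hb i, fun _ => rfl⟩

lemma consistent_of_realizes {β : Type*} {Γ : Set (L.Formula (M ⊕ β))} {c : β → M}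
    (h : Realizes Γ c) : Consistent Γ :=
  fun _ hΔ _ => ⟨c, fun φ hφ => h φ (hΔ hφ)⟩

/-- Saturation for families of definable sets. -/
lemma IsMonster.exists_mem {θ : Cardinal.{w}} (hM : IsMonster L M θ) {A : Set M} (hA : #A < θ)
    {n : ℕ} {ι : Type*} (X : ι → Set (Fin n → M)) (hX : ∀ i, DefinableOver L A (X i))
    (h : ∀ T : Finset ι, ∃ c, ∀ i ∈ T, c ∈ X i) : ∃ c, ∀ i, c ∈ X i := by
  classical
  choose φ hφ hφX using fun i => (hX i).exists_formulaOver
  obtain ⟨c, hc⟩ := hM.saturated A hA n (Set.range φ) ⟨by rintro _ ⟨i, rfl⟩; exact hφ i, by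
    intro Δ hΔ hfin
    obtain ⟨T, rfl⟩ : ∃ T : Finset ι, (T.image φ : Set _) = Δ := by
      obtain ⟨T, -, hT⟩ := Set.exists_subset_image_finite_and.1
        ⟨Δ, by rwa [Set.image_univ], hfin, (rfl : Δ = Δ)⟩
      exact ⟨hT.1.toFinset, by simp [hT.2]⟩
    obtain ⟨c, hc⟩ := h T
    refine ⟨c, fun ψ hψ => ?_⟩
    obtain ⟨i, hi, rfl⟩ := by simpa using hψ
    exact (hφX i c).1 (hc i hi)⟩
  exact ⟨c, fun i => (hφX i c).2 (hc _ ⟨i, rfl⟩)⟩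

end Definable

/-- `F` and `G` induce the same strict preorder on their domain. -/
def OrderEquivalent {V I I' : Type*} [LT I] [LT I'] (F : V → I) (G : V → I') : Prop :=
  ∀ v v', F v < F v' ↔ G v < G v'

-- Indiscernibility as invariance under order-equivalent index maps

section Transfer

variable {L : FirstOrder.Language.{u, v}} {M : Type w} [L.Structure M]

lemma IndiscernibleOver.mono {I : Type*} [LinearOrder I] {n : ℕ} {A B : Set M}
    {a : I → Fin n → M} (h : IndiscernibleOver L B a) (hAB : A ⊆ B) :
    IndiscernibleOver L A a := fun k s t =>
  tp_eq_iff.2 fun X hX => tp_eq_iff.1 (h k s t) X (hX.mono hAB)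

/-- Only a finite set `S` of indices matters. List the values of `F` on `S` increasingly as `s`;
order equivalence makes the corresponding values of `G` an increasing list `t`, with the same
repetitions. So `F` and `G` may be infinite, unordered and non-injective. -/
lemma IndiscernibleOver.mem_iff {I : Type*} [LinearOrder I] {n : ℕ} {A : Set M}
    {a : I → Fin n → M} (h : IndiscernibleOver L A a) {V : Type*} {F G : V → I}
    (hFG : OrderEquivalent F G) {X : Set (V × Fin n → M)} (hX : DefinableOver L A X) :
    (fun x : V × Fin n => a (F x.1) x.2) ∈ X ↔ (fun x : V × Fin n => a (G x.1) x.2) ∈ X := by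
  classical
  obtain ⟨T, hT⟩ := hX.exists_support
  let S := T.image Prod.fst
  have hS : ∀ x ∈ T, x.1 ∈ S := fun x hx => Finset.mem_image_of_mem _ hx
  rcases S.eq_empty_or_nonempty with hS0 | ⟨v₀, hv₀⟩
  · exact hT _ _ fun x hx => absurd (hS x hx) (by simp [hS0])
  let R := S.image F
  let s : Fin R.card ↪o I := R.orderEmbOfFin rfl
  have hs : ∀ v ∈ S, ∃ q, s q = F v := fun v hv => by
    have : F v ∈ Set.range s := by
      rw [Finset.range_orderEmbOfFin]
      exact Finset.mem_image_of_mem _ hv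
    exact this
  choose r hr using fun v => show ∃ q, v ∈ S → s q = F v by
    by_cases hv : v ∈ S
    · obtain ⟨q, hq⟩ := hs v hv
      exact ⟨q, fun _ => hq⟩
    · exact ⟨(hs v₀ hv₀).choose, fun h => absurd h hv⟩
  choose p _ hp using fun q => Finset.mem_image.1 (R.orderEmbOfFin_mem rfl q)
  let t : Fin R.card ↪o I := OrderEmbedding.ofStrictMono (fun q => G (p q)) fun q q' hq => by
    rw [← hFG, hp, hp]
    exact s.strictMono hq
  have ht : ∀ v ∈ S, t (r v) = G v := fun v hv => by
    have e : F (p (r v)) = F v := (hp _).trans (hr v hv)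
    refine le_antisymm (not_lt.1 ?_) (not_lt.1 ?_)
    · exact fun hlt => ((hFG v (p (r v))).2 hlt).ne e.symm
    · exact fun hlt => ((hFG (p (r v)) v).2 hlt).ne e
  have key := tp_eq_iff.1 (h _ s t) _ (hX.comp fun x : V × Fin n => (r x.1, x.2))
  refine (hT _ _ fun x hx => ?_).trans (key.trans (hT _ _ fun x hx => ?_))
  · rw [← hr _ (hS x hx)]
  · rw [← ht _ (hS x hx)]

variable {J : Type*} {I : J → Type*} [∀ j, LinearOrder (I j)] {n : J → ℕ} {A : Set M}
  {a : ∀ j, I j → Fin (n j) → M}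

/-- Finitely many sequences matter. They are moved from `F` to `G` one at a time, the others serving
as parameters. -/
lemma MutuallyIndiscernible.mem_iff (h : MutuallyIndiscernible L A a) {V : J → Type*}
    {F G : ∀ j, V j → I j} (hFG : ∀ j, OrderEquivalent (F j) (G j))
    {X : Set ((Σ j, V j × Fin (n j)) → M)} (hX : DefinableOver L A X) :
    (fun x : Σ j, V j × Fin (n j) => a x.1 (F x.1 x.2.1) x.2.2) ∈ X ↔
      (fun x : Σ j, V j × Fin (n j) => a x.1 (G x.1 x.2.1) x.2.2) ∈ X := by
  classical
  obtain ⟨T, hT⟩ := hX.exists_support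
  have key : ∀ S : Finset J, (fun x : Σ j, V j × Fin (n j) => a x.1 (F x.1 x.2.1) x.2.2) ∈ X ↔
      (fun x : Σ j, V j × Fin (n j) =>
        a x.1 ((if x.1 ∈ S then G x.1 else F x.1) x.2.1) x.2.2) ∈ X := by
    intro S
    induction S using Finset.induction_on with
    | empty => simp
    | insert j S hj ih =>
      rw [ih]
      let H : ∀ j, V j → I j := fun j' => if j' ∈ S then G j' else F j'
      have hX' := hX.preimage (B := A ∪ {x | ∃ j', j' ≠ j ∧ ∃ (i : I j') (l : Fin (n j')),
        a j' i l = x}) Set.subset_union_left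
        (fun (y : V j × Fin (n j) → M) (x : Σ j, V j × Fin (n j)) =>
          if h : x.1 = j then y (h ▸ x.2) else a x.1 (H x.1 x.2.1) x.2.2) (by
          rintro ⟨j', q, l⟩
          by_cases hj' : j' = j
          · subst hj'
            exact Or.inr ⟨(q, l), fun c => by simp⟩
          · exact Or.inl ⟨_, Or.inr ⟨j', hj', H j' q, l, rfl⟩, fun c => by simp [hj']⟩)
      have := (h j).mem_iff (hFG j) hX'
      simp only [Set.mem_ofPred_eq] at this
      convert this using 2
      · ext ⟨j', q, l⟩
        by_cases hj' : j' = j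
        · subst hj'; simp [hj]
        · simp [hj', H]
      · ext ⟨j', q, l⟩
        by_cases hj' : j' = j
        · subst hj'; simp
        · simp [hj', H]
  rw [key (T.image Sigma.fst)]
  refine hT _ _ fun x hx => ?_
  rw [if_pos (Finset.mem_image_of_mem _ hx)]

/-- Sequences built from blocks of mutually indiscernible sequences and from parameters are
mutually indiscernible. -/
lemma MutuallyIndiscernible.blocks (h : MutuallyIndiscernible L A a) {I' : J → Type*}
    [∀ j, LinearOrder (I' j)] {Q : J → Type*} {n' : J → ℕ} (f : ∀ j, I' j → Q j → I j)
    (hf : ∀ j r (s t : Fin r ↪o I' j), OrderEquivalent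
      (fun x : Fin r × Q j => f j (s x.1) x.2) (fun x : Fin r × Q j => f j (t x.1) x.2))
    (τ : ∀ j, Fin (n' j) → A ⊕ (Q j × Fin (n j))) :
    MutuallyIndiscernible L A fun j (i : I' j) (l : Fin (n' j)) =>
      Sum.elim Subtype.val (fun x : Q j × Fin (n j) => a j (f j i x.1) x.2) (τ j l) := by
  intro j r s t
  rw [tp_eq_iff]
  intro X hX
  have hX := hX.mono (B := A ∪ {x | ∃ j', j' ≠ j ∧ ∃ (i : I j') (l : Fin (n j')),
    a j' i l = x}) <| by
      rintro x (hx | ⟨j', hj', i, l, rfl⟩)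
      · exact Or.inl hx
      · dsimp only
        rcases τ j' l with y | ⟨q, l'⟩
        · exact Or.inl y.2
        · exact Or.inr ⟨j', hj', f j' i q, l', rfl⟩
  have := (h j).mem_iff (hf j r s t) (hX.preimage subset_rfl
    (fun (y : (Fin r × Q j) × Fin (n j) → M) (x : Fin r × Fin (n' j)) =>
      Sum.elim Subtype.val (fun z : Q j × Fin (n j) => y ((x.1, z.1), z.2)) (τ j x.2)) (by
      rintro ⟨i, l⟩
      dsimp only
      rcases τ j l with y | ⟨q, l'⟩
      · exact Or.inl ⟨y, Or.inl y.2, fun _ => rfl⟩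
      · exact Or.inr ⟨_, fun _ => rfl⟩))
  exact this

end Transfer

-- Combinatorics of linear orders and pigeonhole principles

section Order

lemma OrderEquivalent.of_strictMono {V I I' : Type*} [LinearOrder V] [LinearOrder I]
    [LinearOrder I'] {F : V → I} {G : V → I'} (hF : StrictMono F) (hG : StrictMono G) :
    OrderEquivalent F G := fun _ _ => hF.lt_iff_lt.trans hG.lt_iff_lt.symm

lemma OrderEquivalent.comp {V W I I' : Type*} [LT I] [LT I'] {F : V → I} {G : V → I'}
    (h : OrderEquivalent F G) (f : W → V) :
    OrderEquivalent (fun x => F (f x)) (fun x => G (f x)) := fun _ _ => h _ _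

lemma OrderEquivalent.monotone_or_antitone_comp {V I I' : Type*} [LinearOrder I]
    [LinearOrder I'] {F G : V → I} (h : OrderEquivalent F G) {e : I → I'}
    (he : StrictMono e ∨ StrictAnti e) :
    OrderEquivalent (fun x => e (F x)) (fun x => e (G x)) := by
  intro v v'
  rcases he with he | he
  · rw [he.lt_iff_lt, he.lt_iff_lt]; exact h _ _
  · rw [he.lt_iff_gt, he.lt_iff_gt]; exact h _ _

/-- With remainders below `B`, the number `B * u + x` compares like the pair `(u, x)`
lexicographically, so shapes need only be compared inside a common block. -/
lemma OrderEquivalent.block {V : Type*} {B : ℕ} {u u' x x' : V → ℕ} (hu : OrderEquivalent u u')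
    (hx : ∀ v, x v < B) (hx' : ∀ v, x' v < B)
    (h : ∀ v v', u v = u v' → (x v < x v' ↔ x' v < x' v')) :
    OrderEquivalent (fun v => B * u v + x v) (fun v => B * u' v + x' v) := by
  have key : ∀ {m m' y y' : ℕ}, y < B → m < m' → B * m + y < B * m' + y' := by
    intro m m' y y' hy hm
    have : B * (m + 1) ≤ B * m' := Nat.mul_le_mul_left _ hm
    rw [Nat.mul_succ] at this
    omega
  intro v v'
  dsimp only
  rcases lt_trichotomy (u v) (u v') with h1 | h1 | h1
  · exact iff_of_true (key (hx v) h1) (key (hx' v) ((hu _ _).1 h1))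
  · have h2 : u' v = u' v' := le_antisymm
      (not_lt.1 fun hlt => ((hu _ _).2 hlt).ne h1.symm) (not_lt.1 fun hlt => ((hu _ _).2 hlt).ne h1)
    rw [h1, h2, Nat.add_lt_add_iff_left, Nat.add_lt_add_iff_left]
    exact h _ _ h1
  · exact iff_of_false (key (hx v') h1).not_gt (key (hx' v') ((hu _ _).1 h1)).not_gt

/-- Every finite configuration in an infinite linear order can be moved into a monotone
sequence. -/
lemma exists_sequence_orderEquivalent {I V : Type*} [LinearOrder I] [Infinite I] [Finite V]
    (F : V → I) : ∃ (e : ℕ → I) (r : V → ℕ), (StrictMono e ∨ StrictAnti e) ∧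
      OrderEquivalent F (fun x => e (r x)) := by
  classical
  have := Fintype.ofFinite V
  let R := Finset.univ.image F
  have hR : ∀ v, F v ∈ R := fun v => Finset.mem_image_of_mem _ (Finset.mem_univ v)
  let f := Infinite.natEmbedding I
  obtain ⟨g, hg | hg⟩ := exists_increasing_or_nonincreasing_subseq (· < ·) f
  -- The position of `F v` is the number of values of `F` below it; in the decreasing case below, it
  -- is the number of values above it.
  · refine ⟨f ∘ g, fun v => (R.filter (· < F v)).card, Or.inl fun _ _ h => hg _ _ h,
      fun v v' => ?_⟩
    have hmono : StrictMono (f ∘ g) := fun _ _ h => hg _ _ h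
    have hlt : ∀ v v', F v < F v' → (R.filter (· < F v)).card < (R.filter (· < F v')).card := by
      intro v v' h
      refine Finset.card_lt_card ⟨fun x hx => ?_, fun hsub => ?_⟩
      · simp only [Finset.mem_filter] at hx ⊢
        exact ⟨hx.1, hx.2.trans h⟩
      · have := hsub (Finset.mem_filter.2 ⟨hR v, h⟩)
        simp at this
    refine Iff.trans ⟨hlt v v', fun h => ?_⟩ hmono.lt_iff_lt.symm
    by_contra hle
    rcases (not_lt.1 hle).eq_or_lt with h' | h'
    · rw [h'] at h; exact h.ne rfl
    · exact (hlt _ _ h').not_gt h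
  · have hanti : StrictAnti (f ∘ g) := fun i j h =>
      (not_lt.1 (hg _ _ h)).lt_of_ne fun h' => h.ne' (g.injective (f.injective h'))
    refine ⟨f ∘ g, fun v => (R.filter (F v < ·)).card, Or.inr hanti, fun v v' => ?_⟩
    have hlt : ∀ v v', F v < F v' → (R.filter (F v' < ·)).card < (R.filter (F v < ·)).card := by
      intro v v' h
      refine Finset.card_lt_card ⟨fun x hx => ?_, fun hsub => ?_⟩
      · simp only [Finset.mem_filter] at hx ⊢
        exact ⟨hx.1, h.trans hx.2⟩
      · have := hsub (Finset.mem_filter.2 ⟨hR v', h⟩)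
        simp at this
    refine Iff.trans ⟨hlt v v', fun h => ?_⟩ hanti.lt_iff_gt.symm
    by_contra hle
    rcases (not_lt.1 hle).eq_or_lt with h' | h'
    · rw [h'] at h; exact h.ne rfl
    · exact (hlt _ _ h').not_gt h

lemma exists_strictMono_constant (T : ℕ → Prop) :
    ∃ (v : Prop) (h : ℕ → ℕ), StrictMono h ∧ ∀ i, T (h i) ↔ v := by
  by_cases hT : ∃ᶠ i in Filter.atTop, T i
  · obtain ⟨h, hmono, hh⟩ := Filter.extraction_of_frequently_atTop hT
    exact ⟨True, h, hmono, fun i => iff_true_intro (hh i)⟩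
  · obtain ⟨h, hmono, hh⟩ := Filter.extraction_of_eventually_atTop (Filter.not_frequently.1 hT)
    exact ⟨False, h, hmono, fun i => iff_false_intro (hh i)⟩

/-- Among `2 * N` numbers, `N` can be chosen on which `T` is constant. -/
lemma exists_strictMono_constant_below (T : ℕ → Prop) (N : ℕ) :
    ∃ (g : ℕ → ℕ) (u : Prop), StrictMono g ∧ (∀ i < N, (T (g i) ↔ u)) ∧
      ∀ i, g (N + i) = 2 * N + i := by
  classical
  obtain ⟨S, u, hS, hSN, hSu⟩ : ∃ (S : Finset ℕ) (u : Prop), S.card = N ∧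
      (∀ x ∈ S, x < 2 * N) ∧ ∀ x ∈ S, T x ↔ u := by
    have hcard := Finset.card_filter_add_card_filter_not (s := Finset.range (2 * N)) T
    rw [Finset.card_range] at hcard
    by_cases h : N ≤ ((Finset.range (2 * N)).filter T).card
    · obtain ⟨S, hS, hSN⟩ := Finset.exists_subset_card_eq h
      refine ⟨S, True, hSN, fun x hx => ?_, fun x hx => ?_⟩
      · exact Finset.mem_range.1 (Finset.mem_filter.1 (hS hx)).1
      · exact iff_true_intro (Finset.mem_filter.1 (hS hx)).2
    · have h' : N ≤ ((Finset.range (2 * N)).filter fun x => ¬ T x).card := by omega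
      obtain ⟨S, hS, hSN⟩ := Finset.exists_subset_card_eq h'
      refine ⟨S, False, hSN, fun x hx => ?_, fun x hx => ?_⟩
      · exact Finset.mem_range.1 (Finset.mem_filter.1 (hS hx)).1
      · exact iff_false_intro (Finset.mem_filter.1 (hS hx)).2
  let s := S.orderEmbOfFin hS
  have hs : ∀ i, s i ∈ S := S.orderEmbOfFin_mem hS
  refine ⟨fun i => if h : i < N then s ⟨i, h⟩ else N + i, u, ?_, fun i hi => ?_, fun i => ?_⟩
  · intro i i' h
    dsimp only
    split_ifs with h1 h2 h2
    · exact s.strictMono h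
    · have := hSN _ (hs ⟨i, h1⟩); omega
    · omega
    · omega
  · simp only [dif_pos hi]
    exact hSu _ (hs _)
  · simp only [dif_neg (show ¬ N + i < N by omega)]
    omega

end Order

-- Copying truth values by saturation

section Realize

variable {L : FirstOrder.Language.{u, v}} {M : Type w} [L.Structure M]

lemma DefinableOver.iff_prop {β : Type*} {A : Set M} {X : Set (β → M)}
    (h : DefinableOver L A X) (w : Prop) : DefinableOver L A {c | c ∈ X ↔ w} := by
  by_cases hw : w
  · simpa [hw] using h
  · simp only [hw, iff_false]
    exact h.compl

/-- Parameters from a tuple `c` can be turned into variables. -/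
lemma DefinableOver.exists_union_range {β : Type*} {m : ℕ} {A : Set M} {c : Fin m → M}
    {X : Set (β → M)} (h : DefinableOver L (A ∪ Set.range c) X) :
    ∃ Y : Set (Fin m ⊕ β → M), DefinableOver L A Y ∧ ∀ d, d ∈ X ↔ Sum.elim c d ∈ Y := by
  obtain ⟨Y, hY, hXY⟩ := h.exists_union
  choose f hf using fun x : Set.range c => x.2
  refine ⟨_, hY.comp (Sum.map f id), fun d => (hXY d).trans (iff_of_eq ?_)⟩
  change _ = ((fun i => Sum.elim c d (Sum.map f id i)) ∈ Y)
  congr 1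
  ext (i | i)
  · exact (hf i).symm
  · rfl

lemma mk_union_range_lt {θ : Cardinal.{w}} (hθ : ℵ₀ < θ) {A : Set M} (hA : #A < θ) {J : Type w}
    (hJ : #J < θ) {V : J → Type*} [∀ j, Countable (V j)] (g : (Σ j, V j) → M) :
    #(A ∪ Set.range g : Set M) < θ := by
  refine (Cardinal.mk_union_le _ _).trans_lt (Cardinal.add_lt_of_lt hθ.le hA ?_)
  choose f hf using fun x : Set.range g => x.2
  choose e he using fun j => exists_injective_nat (V j)
  have hinj : Function.Injective fun x : Set.range g => ((f x).1, e _ (f x).2) := by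
    intro x y hxy
    have key : ∀ {s t : Σ j, V j}, ((s.1, e _ s.2) : J × ℕ) = (t.1, e _ t.2) → s = t := by
      rintro ⟨j, s⟩ ⟨j', t⟩ h
      obtain ⟨rfl, h2⟩ := Prod.mk.inj h
      have := he _ h2
      dsimp only at this
      rw [this]
    exact Subtype.ext (by rw [← hf x, ← hf y, key hxy])
  refine (Cardinal.mk_le_of_injective hinj).trans_lt ?_
  rw [Cardinal.mk_prod, Cardinal.lift_uzero, Cardinal.mk_nat, Cardinal.lift_aleph0]
  exact Cardinal.mul_lt_of_lt hθ.le hJ hθ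

variable [Nonempty M] {θ : Cardinal.{w}} {m : ℕ} {A : Set M} {p : Set (L.Formula (M ⊕ Fin m))}
  {J : Type w} {I : J → Type*} [∀ j, LinearOrder (I j)] {n : J → ℕ}
  {a : ∀ j, I j → Fin (n j) → M}

/-- A configuration of truth values along blocks of mutually indiscernible sequences, realized
together with `p`, is also realized along any blocks of the same order type. -/
lemma IsMonster.exists_realizes_of_orderEquivalent (hM : IsMonster L M θ) (hA : #A < θ)
    (hp : ∀ φ ∈ p, FormulaOver A φ) (hJ : #J < θ) (h : MutuallyIndiscernible L A a)
    {k : J → ℕ} {D E : ∀ j, ℕ → Fin (k j) → I j}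
    (hDE : ∀ j, OrderEquivalent (fun x : ℕ × Fin (k j) => D j x.1 x.2)
      (fun x : ℕ × Fin (k j) => E j x.1 x.2))
    {X : ∀ j, Set (Fin m ⊕ (Fin (k j) × Fin (n j)) → M)} (hX : ∀ j, DefinableOver L A (X j))
    {w : J → ℕ → Prop} {c : Fin m → M} (hc : Realizes p c)
    (hcX : ∀ j i, Sum.elim c (fun x : Fin (k j) × Fin (n j) => a j (D j i x.1) x.2) ∈ X j ↔ w j i) :
    ∃ c', Realizes p c' ∧ ∀ j i,
      Sum.elim c' (fun x : Fin (k j) × Fin (n j) => a j (E j i x.1) x.2) ∈ X j ↔ w j i := by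
  classical
  let O : Set M := Set.range fun x : Σ j, (ℕ × Fin (k j)) × Fin (n j) =>
    a x.1 (E x.1 x.2.1.1 x.2.1.2) x.2.2
  have hO : #(A ∪ O : Set M) < θ := mk_union_range_lt hM.aleph0_lt hA hJ _
  let Y : p ⊕ (J × ℕ) → Set (Fin m → M) := Sum.elim (fun φ => {c | Sat φ.1 c})
    (fun x => {c | Sum.elim c (fun z : Fin (k x.1) × Fin (n x.1) =>
      a x.1 (E x.1 x.2 z.1) z.2) ∈ {d | d ∈ X x.1 ↔ w x.1 x.2}})
  obtain ⟨c', hc'⟩ := hM.exists_mem hO Y (by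
    rintro (φ | ⟨j, i⟩)
    · exact (hp _ φ.2).definableOver.mono Set.subset_union_left
    · exact ((hX j).iff_prop (w j i)).fiber Set.subset_union_left
        fun z => Or.inr ⟨⟨j, (i, z.1), z.2⟩, rfl⟩) (by
    intro T
    let S : p ⊕ (J × ℕ) → Set ((Σ j, (ℕ × Fin (k j)) × Fin (n j)) ⊕ Fin m → M) :=
      Sum.elim (fun φ => {z | (fun i => z (Sum.inr i)) ∈ {c | Sat φ.1 c}})
        (fun x => {z | (fun y => z (Sum.elim Sum.inr (fun y : Fin (k x.1) × Fin (n x.1) =>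
          Sum.inl ⟨x.1, (x.2, y.1), y.2⟩) y)) ∈ {d | d ∈ X x.1 ↔ w x.1 x.2}})
    have hS : ∀ t, DefinableOver L A (S t) := by
      rintro (φ | ⟨j, i⟩)
      · exact (hp _ φ.2).definableOver.comp _
      · exact ((hX j).iff_prop (w j i)).comp _
    -- Solvability of the finitely many conditions in `T` is a property of the blocks definable over
    -- `A`, hence passes from `D` to `E`.
    have key := h.mem_iff (V := fun j => ℕ × Fin (k j)) hDE
      (DefinableOver.biInter T fun t _ => hS t).image_inl
    have aux : ∀ (F : ∀ j, ℕ × Fin (k j) → I j) (d : Fin m → M) (j : J) (i : ℕ),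
        (fun y => Sum.elim (fun x : Σ j, (ℕ × Fin (k j)) × Fin (n j) =>
          a x.1 (F x.1 x.2.1) x.2.2) d (Sum.elim Sum.inr (fun y : Fin (k j) × Fin (n j) =>
          Sum.inl ⟨j, (i, y.1), y.2⟩) y)) =
        Sum.elim d (fun z : Fin (k j) × Fin (n j) => a j (F j (i, z.1)) z.2) := by
      intro F d j i
      ext (y | y) <;> rfl
    obtain ⟨d, hd⟩ := key.1 ⟨c, Set.mem_iInter₂.2 fun t _ => by
      rcases t with φ | ⟨j, i⟩
      · exact hc _ φ.2
      · exact (iff_of_eq (congrArg (fun y => (y ∈ X j ↔ w j i))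
          (aux (fun j x => D j x.1 x.2) c j i))).mpr (hcX j i)⟩
    refine ⟨d, fun t ht => ?_⟩
    have := Set.mem_iInter₂.1 hd t ht
    rcases t with φ | ⟨j, i⟩
    · exact this
    · exact (iff_of_eq (congrArg (fun y => (y ∈ X j ↔ w j i))
        (aux (fun j x => E j x.1 x.2) d j i))).mp this)
  exact ⟨c', fun φ hφ => hc' (Sum.inl ⟨φ, hφ⟩), fun j i => hc' (Sum.inr (j, i))⟩

end Realize

-- From failure of indiscernibility to a randomness pattern

section Pattern

variable {L : FirstOrder.Language.{u, v}} {M : Type w} [L.Structure M]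

lemma exists_definableOver_of_not_indiscernibleOver {m n : ℕ} {A : Set M} {I : Type*}
    [LinearOrder I] {a : I → Fin n → M} {c : Fin m → M}
    (h : ¬ IndiscernibleOver L (A ∪ Set.range c) a) :
    ∃ (k : ℕ) (s t : Fin k ↪o I) (X : Set (Fin m ⊕ (Fin k × Fin n) → M)), DefinableOver L A X ∧
      Sum.elim c (fun x : Fin k × Fin n => a (s x.1) x.2) ∈ X ∧
      Sum.elim c (fun x : Fin k × Fin n => a (t x.1) x.2) ∉ X := by
  simp only [IndiscernibleOver, not_forall, tp_eq_iff] at h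
  obtain ⟨k, s, t, X, hX, hne⟩ := h
  obtain ⟨Y, hY, hXY⟩ := hX.exists_union_range
  rw [hXY, hXY] at hne
  by_cases hs : Sum.elim c (fun x : Fin k × Fin n => a (s x.1) x.2) ∈ Y
  · exact ⟨k, s, t, Y, hY, hs, fun ht => hne (iff_of_true hs ht)⟩
  · exact ⟨k, s, t, Yᶜ, hY.compl, hs, fun ht => hne (iff_of_false hs ht)⟩

variable [Nonempty M] {θ : Cardinal.{w}} {m : ℕ} {A : Set M} {p : Set (L.Formula (M ⊕ Fin m))}
  {J : Type w} {I : J → Type*} [∀ j, LinearOrder (I j)] {n : J → ℕ}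
  {a : ∀ j, I j → Fin (n j) → M}

/-- The gain over the hypothesis is uniformity: a single block shape `r j`, and a single value `v j`
valid for every choice of starting blocks `l`. Nothing is claimed about the blocks before `l j`. -/
lemma MutuallyIndiscernible.exists_truth_values [∀ j, Infinite (I j)] (hM : IsMonster L M θ)
    (hA : #A < θ) (hp : ∀ φ ∈ p, FormulaOver A φ) (hJ : #J < θ)
    (h : MutuallyIndiscernible L A a) {c : Fin m → M} (hc : Realizes p c)
    (hne : ∀ j, ¬ IndiscernibleOver L (A ∪ Set.range c) (a j)) :
    ∃ (e : ∀ j, ℕ → I j) (k : J → ℕ) (B : J → ℕ) (r : ∀ j, Fin (k j) → ℕ)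
      (X : ∀ j, Set (Fin m ⊕ (Fin (k j) × Fin (n j)) → M)) (v : J → Prop),
      (∀ j, StrictMono (e j) ∨ StrictAnti (e j)) ∧ (∀ j q, r j q < B j) ∧
      (∀ j, DefinableOver L A (X j)) ∧ ∀ l : J → ℕ, ∃ c', Realizes p c' ∧ ∀ j i,
        Sum.elim c' (fun x : Fin (k j) × Fin (n j) => a j (e j (B j * (l j + i) + r j x.1)) x.2)
          ∈ X j ↔ (v j ↔ i ≠ 0) := by
  classical
  choose k s t X hX hs ht using fun j => exists_definableOver_of_not_indiscernibleOver (hne j)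
  choose e r he her using fun j =>
    exists_sequence_orderEquivalent (Sum.elim (s j) (t j) : Fin (k j) ⊕ Fin (k j) → I j)
  -- Copy the true and the false tuple into the monotone sequence `e j`: block `0` is the true one,
  -- and all other blocks repeat the false one.
  obtain ⟨c₁, hc₁, hc₁X⟩ := hM.exists_realizes_of_orderEquivalent hA hp hJ h
    (D := fun j i q => Sum.elim (s j) (t j) (if i = 0 then Sum.inl q else Sum.inr q))
    (E := fun j i q => e j (r j (if i = 0 then Sum.inl q else Sum.inr q)))
    (fun j => (her j).comp fun x : ℕ × Fin (k j) => if x.1 = 0 then Sum.inl x.2 else Sum.inr x.2)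
    hX (w := fun _ i => i = 0) hc (by
      intro j i
      by_cases hi : i = 0
      · simpa [hi] using hs j
      · simpa [hi] using ht j)
  have hB : ∀ j, ∃ B, ∀ x, r j x < B := fun j =>
    ⟨Finset.univ.sup (r j) + 1, fun x => Nat.lt_succ_of_le (Finset.le_sup (Finset.mem_univ x))⟩
  choose B hB using hB
  have hst : ∀ j, OrderEquivalent (fun q => r j (Sum.inr q)) (fun q => r j (Sum.inl q)) := by
    intro j q q'
    have h1 := her j (Sum.inl q) (Sum.inl q')
    have h2 := her j (Sum.inr q) (Sum.inr q')
    have h3 := her j (Sum.inl q') (Sum.inl q)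
    have h4 := her j (Sum.inr q') (Sum.inr q)
    simp only [Sum.elim_inl, Sum.elim_inr, OrderEmbedding.lt_iff_lt] at h1 h2 h3 h4
    rcases he j with he | he
    · rw [he.lt_iff_lt] at h1 h2
      exact h2.symm.trans h1
    · rw [he.lt_iff_gt] at h3 h4
      exact h4.symm.trans h3
  choose v g hg hgv using fun j => exists_strictMono_constant fun i =>
    Sum.elim c₁ (fun x : Fin (k j) × Fin (n j) =>
      a j (e j (B j * (i + 1) + r j (Sum.inl x.1))) x.2) ∈ X j
  -- Block `0` contains both a true and a false tuple of the same shape; take the one whose value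
  -- differs from the eventual value `v j`.
  have hρ : ∀ j, ∃ ρ : Fin (k j) → ℕ, (∀ q, ρ q < B j) ∧
      OrderEquivalent ρ (fun q => r j (Sum.inl q)) ∧
      (Sum.elim c₁ (fun x : Fin (k j) × Fin (n j) => a j (e j (ρ x.1)) x.2) ∈ X j ↔ ¬ v j) := by
    intro j
    by_cases hv : v j
    · exact ⟨_, fun q => hB j _, hst j, (hc₁X j 1).trans (by simp [hv])⟩
    · exact ⟨_, fun q => hB j _, fun _ _ => Iff.rfl, (hc₁X j 0).trans (by simp [hv])⟩
  choose ρ hρB hρ hρv using hρ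
  refine ⟨e, k, B, fun j q => r j (Sum.inl q), X, v, he, fun j q => hB j _, hX, fun l => ?_⟩
  -- The exceptional tuple lives in block `0`, followed by the blocks on which the value is
  -- constantly `v j`. The shift by one keeps these clear of block `0`.
  let u : ∀ _ : J, ℕ → ℕ := fun j i => if i = 0 then 0 else g j (i - 1) + 1
  have hu : ∀ j, StrictMono (u j) := by
    intro j i i' hlt
    by_cases hi : i = 0
    · simp [u, hi, show i' ≠ 0 by omega]
    · have := hg j (show i - 1 < i' - 1 by omega)
      simp only [u, hi, show i' ≠ 0 by omega, if_false]
      omega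
  refine hM.exists_realizes_of_orderEquivalent hA hp hJ h
    (D := fun j i q => e j (B j * u j i + if i = 0 then ρ j q else r j (Sum.inl q)))
    (E := fun j i q => e j (B j * (l j + i) + r j (Sum.inl q))) (w := fun j i => v j ↔ i ≠ 0)
    (fun j => ?_) hX hc₁ fun j i => ?_
  · refine OrderEquivalent.monotone_or_antitone_comp (OrderEquivalent.block
      ((OrderEquivalent.of_strictMono (hu j) (G := fun i => l j + i)
        fun _ _ h => Nat.add_lt_add_left h _).comp Prod.fst)
      (fun x => ?_) (fun x => hB j _) ?_) (he j)
    · split_ifs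
      exacts [hρB j _, hB j _]
    · rintro ⟨i, q⟩ ⟨i', q'⟩ hi
      obtain rfl := (hu j).injective hi
      dsimp only
      split_ifs
      exacts [hρ j _ _, Iff.rfl]
  · rcases i with - | i
    · simpa [u] using hρv j
    · simpa [u] using hgv j i

/-- Mutually indiscernible sequences, none of which stays indiscernible over a realization of
`p`, give a randomness pattern for `p`. -/
theorem hasRandomnessPattern_of_not_indiscernibleOver [∀ j, Infinite (I j)]
    (hM : IsMonster L M θ) (hA : #A < θ) (hp : ∀ φ ∈ p, FormulaOver A φ) (hJ : #J < θ)
    (h : MutuallyIndiscernible L A a) {c : Fin m → M} (hc : Realizes p c)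
    (hne : ∀ j, ¬ IndiscernibleOver L (A ∪ Set.range c) (a j)) :
    HasRandomnessPattern A p #J := by
  classical
  obtain ⟨e, k, B, r, X, v, he, hB, hX, hl⟩ := h.exists_truth_values hM hA hp hJ hc hne
  let T : (Fin m → M) → J → ℕ → Prop := fun c j i => Sum.elim c
    (fun x : Fin (k j) × Fin (n j) => a j (e j (B j * i + r j x.1)) x.2) ∈ X j
  have hpattern : ∀ η : J → ℕ, ∃ c, Realizes p c ∧ ∀ j i,
      ((T c j (2 * i) ↔ ¬ v j) ∧ (T c j (2 * i + 1) ↔ v j)) ↔ i = η j := by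
    intro η
    -- The exceptional block is placed at `4 * η j`, so that pigeonhole leaves `2 * η j` earlier
    -- blocks of constant value. After thinning it sits at `2 * η j`, the first half of pair number
    -- `η j`.
    obtain ⟨c₂, hc₂, hT₂⟩ := hl fun j => 2 * (2 * η j)
    choose g u hg hgu hgη using fun j => exists_strictMono_constant_below (T c₂ j) (2 * η j)
    obtain ⟨c₃, hc₃, hT₃⟩ := hM.exists_realizes_of_orderEquivalent hA hp hJ h
      (D := fun j i q => e j (B j * g j i + r j q)) (E := fun j i q => e j (B j * i + r j q))
      (fun j => OrderEquivalent.monotone_or_antitone_comp (OrderEquivalent.block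
        ((OrderEquivalent.of_strictMono (hg j) (G := fun i => i) strictMono_id).comp Prod.fst)
        (fun x => hB j _) (fun x => hB j _) (fun _ _ _ => Iff.rfl)) (he j))
      hX (w := fun j i => T c₂ j (g j i)) hc₂ (fun _ _ => Iff.rfl)
    refine ⟨c₃, hc₃, fun j i => ?_⟩
    have h₃ : ∀ i, T c₃ j i ↔ T c₂ j (g j i) := hT₃ j
    have h₂ : ∀ i, T c₂ j (g j (2 * η j + i)) ↔ (v j ↔ i ≠ 0) := fun i => by
      rw [hgη]; exact hT₂ j i
    rw [h₃, h₃]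
    rcases lt_trichotomy i (η j) with hi | rfl | hi
    · rw [hgu j _ (by omega), hgu j _ (by omega)]
      refine iff_of_false (fun hh => ?_) hi.ne
      have := hh.1.symm.trans hh.2
      tauto
    · have h0 := h₂ 0
      have h1 := h₂ 1
      rw [add_zero] at h0
      rw [h0, h1]
      simp
    · obtain ⟨d, rfl⟩ := Nat.exists_eq_add_of_lt hi
      have h0 := h₂ (2 * (d + 1))
      rw [show 2 * η j + 2 * (d + 1) = 2 * (η j + d + 1) by ring] at h0
      rw [h0]
      refine iff_of_false (fun hh => ?_) hi.ne'
      have := hh.1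
      simp at this
  -- The set of those `x` and pairs of blocks with value `¬v j` on the first block and `v j` on the
  -- second.
  let Ψ : ∀ j, Set (Fin m ⊕ ((Fin 2 × Fin (k j)) × Fin (n j)) → M) := fun j =>
    {z | (fun y => z (Sum.map id (fun x : Fin (k j) × Fin (n j) => ((0, x.1), x.2)) y)) ∈
      {d | d ∈ X j ↔ ¬ v j}} ∩
    {z | (fun y => z (Sum.map id (fun x : Fin (k j) × Fin (n j) => ((1, x.1), x.2)) y)) ∈
      {d | d ∈ X j ↔ v j}}
  have hΨ : ∀ j, DefinableOver L A (Ψ j) := fun j =>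
    (((hX j).iff_prop _).comp _).inter (((hX j).iff_prop _).comp _)
  -- The formulas of a pattern carry no parameters, so those of `Ψ j` become constant entries of the
  -- tuples `b j i`.
  choose P hP d φ hφ using fun j => (hΨ j).exists_finite_parameters
  let ε := fun j => Finite.equivFin (P j ⊕ ((Fin 2 × Fin (k j)) × Fin (n j)))
  let f : ∀ j, ℕ → Fin 2 × Fin (k j) → I j := fun j i x =>
    e j (B j * (2 * i + x.1) + r j x.2)
  let b := fun j (i : ℕ) l => Sum.elim Subtype.val
    (fun x : (Fin 2 × Fin (k j)) × Fin (n j) => a j (f j i x.1) x.2)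
    (Sum.map (d j) id ((ε j).symm l))
  let ψ : ∀ j, L.Formula (Fin m ⊕ Fin (Nat.card (P j ⊕ ((Fin 2 × Fin (k j)) × Fin (n j))))) :=
    fun j => (φ j).relabel (Sum.elim (fun x => Sum.inr (ε j (Sum.inl x)))
      (Sum.elim Sum.inl fun x => Sum.inr (ε j (Sum.inr x))))
  have hψ : ∀ c j i, Sat (plug (ψ j) (b j i)) c ↔
      ((T c j (2 * i) ↔ ¬ v j) ∧ (T c j (2 * i + 1) ↔ v j)) := by
    intro c j i
    rw [sat_plug, Formula.realize_relabel]
    have e1 : (Sum.elim c (b j i) ∘ Sum.elim (fun x => Sum.inr (ε j (Sum.inl x)))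
        (Sum.elim Sum.inl fun x => Sum.inr (ε j (Sum.inr x)))) =
        Sum.elim (fun i => (d j i : M)) (Sum.elim c
          fun x : (Fin 2 × Fin (k j)) × Fin (n j) => a j (f j i x.1) x.2) := by
      ext (x | x | x) <;> simp [b]
    rw [e1, ← hφ]
    have e2 : ∀ δ : Fin 2, (fun y => Sum.elim c
        (fun x : (Fin 2 × Fin (k j)) × Fin (n j) => a j (f j i x.1) x.2)
        (Sum.map id (fun x : Fin (k j) × Fin (n j) => ((δ, x.1), x.2)) y)) =
        Sum.elim c (fun x : Fin (k j) × Fin (n j) =>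
          a j (e j (B j * (2 * i + δ) + r j x.1)) x.2) := by
      intro δ
      ext (y | y) <;> rfl
    refine and_congr ?_ ?_
    · exact iff_of_eq (congrArg (fun y => (y ∈ X j ↔ ¬ v j)) (e2 0))
    · exact iff_of_eq (congrArg (fun y => (y ∈ X j ↔ v j)) (e2 1))
  refine ⟨J, _, b, ψ, rfl, h.blocks f (fun j R s t => ?_) fun j l => Sum.map (d j) id ((ε j).symm l),
    fun η => ?_⟩
  · refine OrderEquivalent.monotone_or_antitone_comp (OrderEquivalent.block
      (fun x x' => ?_) (fun x => hB j _) (fun x => hB j _) (fun _ _ _ => Iff.rfl)) (he j)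
    obtain ⟨q, δ, z⟩ := x
    obtain ⟨q', δ', z'⟩ := x'
    have h1 : s q < s q' ↔ t q < t q' := by rw [s.lt_iff_lt, t.lt_iff_lt]
    have h2 : s q' < s q ↔ t q' < t q := by rw [s.lt_iff_lt, t.lt_iff_lt]
    have := δ.2
    have := δ'.2
    dsimp only
    omega
  · obtain ⟨c₃, hc₃, hη⟩ := hpattern η
    refine consistent_of_realizes (c := c₃) ?_
    rintro χ ((hχ | ⟨j, rfl⟩) | ⟨j, i, hi, rfl⟩)
    · exact hc₃ χ hχ
    · exact (hψ _ _ _).2 ((hη j _).2 rfl)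
    · rw [sat_not, hψ, hη]
      exact hi

end Pattern

-- Limits of types along an ultrafilter

section Limit

variable {L : FirstOrder.Language.{u, v}} {M : Type w} [L.Structure M]

lemma exists_of_wellFoundedLT {W : Type*} [LT W] [WellFoundedLT W] {D : W → Type*}
    (P : ∀ w, (∀ w', w' < w → D w') → D w → Prop) (h : ∀ w g, ∃ d, P w g d) :
    ∃ f : ∀ w, D w, ∀ w, P w (fun w' _ => f w') (f w) := by
  let f : ∀ w, D w := WellFoundedLT.fix fun w g => (h w g).choose
  refine ⟨f, fun w => ?_⟩
  have : f w = (h w fun w' _ => f w').choose := WellFoundedLT.fix_eq _ _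
  rw [this]
  exact (h w fun w' _ => f w').choose_spec

variable {J : Type w} {n : J → ℕ}

variable (L) in
/-- In the lexicographic order, each tuple `b' j i` realizes over `C` and the preceding tuples
the limit of the types of the tuples `b j k` along the ultrafilter `U`. -/
def IsLimitFamily [LinearOrder J] (U : Ultrafilter ℕ) (C : Set M)
    (b b' : ∀ j, ℕ → Fin (n j) → M) : Prop :=
  ∀ j i (X : Set (Fin (n j) → M)),
    DefinableOver L (C ∪ Set.range fun x : Σ y : {y : J ×ₗ ℕ // y < toLex (j, i)},
      Fin (n (ofLex y.1).1) => b' _ (ofLex x.1.1).2 x.2) X →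
    (b' j i ∈ X ↔ ∀ᶠ k in U, b j k ∈ X)

lemma IsMonster.exists_isLimitFamily {θ : Cardinal.{w}} (hM : IsMonster L M θ) (hJ : #J < θ)
    [LinearOrder J] [WellFoundedLT J] (U : Ultrafilter ℕ) {C : Set M} (hC : #C < θ)
    (b : ∀ j, ℕ → Fin (n j) → M) : ∃ b', IsLimitFamily L U C b b' := by
  classical
  obtain ⟨f, hf⟩ := exists_of_wellFoundedLT (W := J ×ₗ ℕ)
    (D := fun y => Fin (n (ofLex y).1) → M)
    (fun y g d => ∀ X, DefinableOver L (C ∪ Set.range fun x : Σ y' : {y' : J ×ₗ ℕ // y' < y},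
      Fin (n (ofLex y'.1).1) => g x.1.1 x.1.2 x.2) X → (∀ᶠ k in U, b _ k ∈ X) → d ∈ X) (by
    intro y g
    have hW : #{y' : J ×ₗ ℕ // y' < y} < θ := by
      refine (Cardinal.mk_subtype_le _).trans_lt ?_
      change #(J × ℕ) < θ
      rw [Cardinal.mk_prod, Cardinal.lift_uzero, Cardinal.mk_nat, Cardinal.lift_aleph0]
      exact Cardinal.mul_lt_of_lt hM.aleph0_lt.le hJ hM.aleph0_lt
    let ι := {X : Set (Fin (n (ofLex y).1) → M) //
      DefinableOver L (C ∪ Set.range fun x : Σ y' : {y' : J ×ₗ ℕ // y' < y},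
        Fin (n (ofLex y'.1).1) => g x.1.1 x.1.2 x.2) X ∧ ∀ᶠ k in U, b _ k ∈ X}
    obtain ⟨d, hd⟩ := hM.exists_mem (mk_union_range_lt hM.aleph0_lt hC hW _)
      (fun X : ι => X.1) (fun X => X.2.1) fun T => by
        obtain ⟨k, hk⟩ := ((Filter.eventually_all_finset T).2 fun X _ => X.2.2).exists
        exact ⟨_, hk⟩
    exact ⟨d, fun X hX hU => hd ⟨X, hX, hU⟩⟩)
  refine ⟨fun j i => f (toLex (j, i)), fun j i X hX => ⟨fun h => ?_, hf (toLex (j, i)) X hX⟩⟩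
  -- The recursion only asks for the large sets to contain the tuple; a set that is not large has a
  -- large complement.
  by_contra hU
  exact hf (toLex (j, i)) Xᶜ hX.compl (Ultrafilter.eventually_not.2 hU) h

variable {V : Type*} {α : V → J} {U : Ultrafilter ℕ} {C : Set M}
  {b b' : ∀ j, ℕ → Fin (n j) → M} {m₀ : M}

open Classical in
/-- The family of the tuples `b (α v) (F v)` for `v ∈ S`, padded with `m₀`. -/
noncomputable def padded (b : ∀ j, ℕ → Fin (n j) → M) (m₀ : M) (S : Finset V) (F : V → ℕ)
    (x : Σ v, Fin (n (α v))) : M :=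
  if x.1 ∈ S then b (α x.1) (F x.1) x.2 else m₀

open Classical in
/-- Replace the tuple with index `k` by `d`. -/
noncomputable def replace (k : V) (d : Fin (n (α k)) → M) (y : (Σ v, Fin (n (α v))) → M)
    (x : Σ v, Fin (n (α v))) : M :=
  if h : x.1 = k then d (h ▸ x.2) else y x

lemma padded_congr {S : Finset V} {F G : V → ℕ} (h : ∀ v ∈ S, F v = G v) :
    (padded b m₀ S F : (Σ v, Fin (n (α v))) → M) = padded b m₀ S G := by
  ext x
  by_cases hx : x.1 ∈ S <;> simp [padded, hx, h]

lemma padded_insert [DecidableEq V] {S : Finset V} {k : V} (F : V → ℕ) :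
    (padded b m₀ (insert k S) F : (Σ v, Fin (n (α v))) → M) =
      replace k (b (α k) (F k)) (padded b m₀ S F) := by
  ext ⟨v, l⟩
  by_cases hv : v = k
  · subst hv; simp [padded, replace]
  · simp [padded, replace, hv]

lemma DefinableOver.replace {X : Set ((Σ v, Fin (n (α v))) → M)} (hX : DefinableOver L C X)
    {k : V} {d : Fin (n (α k)) → M} (hd : ∀ l, d l ∈ C) :
    DefinableOver L C {y | DpRank.replace k d y ∈ X} :=
  hX.preimage subset_rfl _ <| by
    rintro ⟨v, l⟩
    by_cases hv : v = k
    · subst hv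
      exact Or.inl ⟨d l, hd l, fun y => by simp [DpRank.replace]⟩
    · exact Or.inr ⟨⟨v, l⟩, fun y => by simp [DpRank.replace, hv]⟩

lemma IsLimitFamily.padded_insert_mem_iff [LinearOrder J] [DecidableEq V]
    (h : IsLimitFamily L U C b b') (hm₀ : m₀ ∈ C) {S : Finset V} {k : V} {F : V → ℕ}
    (hk : ∀ v ∈ S, toLex (α v, F v) < toLex (α k, F k))
    {X : Set ((Σ v, Fin (n (α v))) → M)} (hX : DefinableOver L C X) :
    padded b' m₀ (insert k S) F ∈ X ↔
      ∀ᶠ i in U, replace k (b (α k) i) (padded b' m₀ S F) ∈ X := by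
  rw [padded_insert]
  refine h _ _ {d | replace k d (padded b' m₀ S F) ∈ X}
    (hX.preimage Set.subset_union_left _ ?_)
  rintro ⟨v, l⟩
  by_cases hv : v = k
  · subst hv
    exact Or.inr ⟨l, fun y => by simp [replace]⟩
  · by_cases hvS : v ∈ S
    · exact Or.inl ⟨b' (α v) (F v) l, Or.inr ⟨⟨⟨toLex (α v, F v), hk v hvS⟩, l⟩, rfl⟩,
        fun y => by simp [replace, hv, padded, hvS]⟩
    · exact Or.inl ⟨m₀, Or.inl hm₀, fun y => by simp [replace, hv, padded, hvS]⟩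

/-- Peel off the lexicographically last tuple. Its limit type is computed from the original tuples
`b (α k) i`, which lie in `C` and depend on `α k` but not on the index `F k` or `G k`; the induction
applies to each resulting set over `C`. -/
lemma IsLimitFamily.padded_mem_iff [LinearOrder J] (h : IsLimitFamily L U C b b')
    (hb : ∀ j i l, b j i l ∈ C) (hm₀ : m₀ ∈ C) {F G : V → ℕ}
    (hF : Function.Injective fun v => toLex (α v, F v))
    (hFG : OrderEquivalent (fun v => toLex (α v, F v)) fun v => toLex (α v, G v))
    (S : Finset V) {X : Set ((Σ v, Fin (n (α v))) → M)} (hX : DefinableOver L C X) :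
    padded b' m₀ S F ∈ X ↔ padded b' m₀ S G ∈ X := by
  classical
  induction S using Finset.induction_on_max_value (fun v => toLex (α v, F v)) generalizing X with
  | empty =>
    refine iff_of_eq (congrArg (· ∈ X) ?_)
    ext x
    simp [padded]
  | insert k S hkS hk ih =>
    have hk' : ∀ v ∈ S, toLex (α v, F v) < toLex (α k, F k) := fun v hv =>
      (hk v hv).lt_of_ne fun he => hkS (hF he ▸ hv)
    rw [h.padded_insert_mem_iff hm₀ hk' hX,
      h.padded_insert_mem_iff hm₀ (fun v hv => (hFG _ _).1 (hk' v hv)) hX]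
    exact Filter.eventually_congr (Filter.Eventually.of_forall fun i => ih (hX.replace (hb _ i)))

/-- Limit tuples are replaced by original ones from the last downwards. At each stage the suitable
indices form a set in a nonprincipal ultrafilter, so the finite set `E` of indices already used can
be avoided. -/
lemma IsLimitFamily.exists_padded_mem [LinearOrder J] (h : IsLimitFamily L U C b b')
    (hU : (U : Filter ℕ) ≤ Filter.cofinite) (hb : ∀ j i l, b j i l ∈ C) (hm₀ : m₀ ∈ C)
    {F : V → ℕ} (hF : Function.Injective fun v => toLex (α v, F v)) (S : Finset V)
    {X : Set ((Σ v, Fin (n (α v))) → M)} (hX : DefinableOver L C X)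
    (hbX : padded b' m₀ S F ∈ X) (E : Finset ℕ) :
    ∃ f : V → ℕ, Set.InjOn f S ∧ (∀ v ∈ S, f v ∉ E) ∧ padded b m₀ S f ∈ X := by
  classical
  induction S using Finset.induction_on_max_value (fun v => toLex (α v, F v))
    generalizing X E with
  | empty =>
    refine ⟨F, by simp, by simp, ?_⟩
    convert hbX using 1
    ext x
    simp [padded]
  | insert k S hkS hk ih =>
    have hk' : ∀ v ∈ S, toLex (α v, F v) < toLex (α k, F k) := fun v hv =>
      (hk v hv).lt_of_ne fun he => hkS (hF he ▸ hv)
    rw [h.padded_insert_mem_iff hm₀ hk' hX] at hbX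
    obtain ⟨i, hi, hiE⟩ := (hbX.and (hU E.finite_toSet.eventually_cofinite_notMem)).exists
    obtain ⟨f, hf, hfE, hfX⟩ := ih (hX.replace (hb _ i)) hi (insert i E)
    have hfk : ∀ v ∈ S, Function.update f k i v = f v := fun v hv =>
      Function.update_of_ne (ne_of_mem_of_not_mem hv hkS) _ _
    refine ⟨Function.update f k i, ?_, fun v hv => ?_, ?_⟩
    · rw [Finset.coe_insert, Set.injOn_insert (by simpa using hkS)]
      refine ⟨fun v hv v' hv' e => ?_, ?_⟩
      · rw [hfk v hv, hfk v' hv'] at e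
        exact hf hv hv' e
      · rintro ⟨v, hv, e⟩
        rw [hfk v hv, Function.update_self] at e
        exact hfE v hv (by simp [e])
    · rcases Finset.mem_insert.1 hv with rfl | hv
      · simpa using hiE
      · rw [hfk v hv]
        exact fun hE => hfE v hv (Finset.mem_insert_of_mem hE)
    · rw [padded_insert, Function.update_self, padded_congr hfk]
      exact hfX

/-- Keep the other sequences fixed and move the indices within sequence `j`. Since the lexicographic
order compares the sequence first, such a move preserves the order type of the whole configuration.
-/
lemma IsLimitFamily.mutuallyIndiscernible [LinearOrder J] (h : IsLimitFamily L U C b b')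
    (hb : ∀ j i l, b j i l ∈ C) (hm₀ : m₀ ∈ C) : MutuallyIndiscernible L C b' := by
  classical
  intro j r s t
  rw [tp_eq_iff]
  intro X hX
  obtain ⟨Y, hY, hXY⟩ := hX.exists_union
  choose j' hj' i' l' hO using fun x : {x | ∃ j', j' ≠ j ∧ ∃ (i : ℕ) (l : Fin (n j')),
    b' j' i l = x} => x.2
  let α : Fin r ⊕ {y : J × ℕ // y.1 ≠ j} → J := Sum.elim (fun _ => j) fun y => y.1.1
  let F : (Fin r ↪o ℕ) → Fin r ⊕ {y : J × ℕ // y.1 ≠ j} → ℕ := fun s =>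
    Sum.elim s fun y => y.1.2
  have hinj : ∀ s, Function.Injective fun v => toLex (α v, F s v) := by
    intro s v v' hvv'
    have h1 : α v = α v' := congrArg (fun z => (ofLex z).1) hvv'
    have h2 : F s v = F s v' := congrArg (fun z => (ofLex z).2) hvv'
    rcases v with q | y <;> rcases v' with q' | y'
    · exact congrArg _ (s.injective h2)
    · exact absurd h1.symm y'.2
    · exact absurd h1 y.2
    · exact congrArg _ (Subtype.ext (Prod.ext h1 h2))
  have hord : OrderEquivalent (fun v => toLex (α v, F s v)) fun v => toLex (α v, F t v) := by
    intro v v'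
    simp only [Prod.Lex.toLex_lt_toLex]
    rcases v with q | y <;> rcases v' with q' | y'
    · simp [α, F]
    · have := y'.2.symm
      simp [α, F, this]
    · have := y.2
      simp [α, F, this]
    · simp [α, F]
  let g : {x | ∃ j', j' ≠ j ∧ ∃ (i : ℕ) (l : Fin (n j')), b' j' i l = x} ⊕ (Fin r × Fin (n j)) →
      Σ v, Fin (n (α v)) :=
    Sum.elim (fun x => ⟨Sum.inr ⟨(j' x, i' x), hj' x⟩, l' x⟩) fun x => ⟨Sum.inl x.1, x.2⟩
  have hZ := hY.comp g
  obtain ⟨T, hT⟩ := hZ.exists_support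
  have key : ∀ s : Fin r ↪o ℕ, (fun q : Fin r × Fin (n j) => b' j (s q.1) q.2) ∈ X ↔
      padded b' m₀ (T.image Sigma.fst) (F s) ∈ {c | (fun i => c (g i)) ∈ Y} := by
    intro s
    rw [hXY, ← hT (fun x : Σ v, Fin (n (α v)) => b' (α x.1) (F s x.1) x.2)]
    · refine iff_of_eq (congrArg (· ∈ Y) ?_)
      ext (x | x)
      · exact (hO x).symm
      · rfl
    · intro x hx
      simp only [padded, if_pos (Finset.mem_image_of_mem Sigma.fst hx)]
  rw [key, key]
  exact h.padded_mem_iff hb hm₀ (hinj s) hord _ hZ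

lemma IsLimitFamily.exists_mem [LinearOrder J] (h : IsLimitFamily L U C b b')
    (hU : (U : Filter ℕ) ≤ Filter.cofinite) (hb : ∀ j i l, b j i l ∈ C) (hm₀ : m₀ ∈ C)
    {X : Set ((Σ j, ℕ × Fin (n j)) → M)} (hX : DefinableOver L C X)
    (hbX : (fun x : Σ j, ℕ × Fin (n j) => b' x.1 x.2.1 x.2.2) ∈ X) (S : Finset (J × ℕ)) :
    ∃ f : J × ℕ → ℕ, Set.InjOn f S ∧
      (fun x : Σ j, ℕ × Fin (n j) => b x.1 (f (x.1, x.2.1)) x.2.2) ∈ X := by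
  classical
  have hZ := hX.comp fun x : Σ j, ℕ × Fin (n j) =>
    (⟨(x.1, x.2.1), x.2.2⟩ : Σ v : J × ℕ, Fin (n v.1))
  obtain ⟨T, hT⟩ := hZ.exists_support
  have key : ∀ (b : ∀ j, ℕ → Fin (n j) → M) (f : J × ℕ → ℕ),
      padded (α := Prod.fst) b m₀ (S ∪ T.image Sigma.fst) f ∈ _ ↔ _ := fun b f =>
    hT _ (fun x : Σ v : J × ℕ, Fin (n v.1) => b x.1.1 (f x.1) x.2) fun x hx => by
      rw [padded, if_pos (Finset.mem_union_right _ (Finset.mem_image_of_mem _ hx))]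
  obtain ⟨f, hf, -, hfX⟩ := h.exists_padded_mem (F := Prod.snd) hU hb hm₀ (fun _ _ e => e)
    (S ∪ T.image Sigma.fst) hZ ((key b' Prod.snd).2 hbX) ∅
  exact ⟨f, hf.mono (by simp), (key b f).1 hfX⟩

end Limit

-- Changing the base set of a randomness pattern

section BaseChange

variable {L : FirstOrder.Language.{u, v}} {M : Type w} [L.Structure M] {θ : Cardinal.{w}}
  {m : ℕ} {A B : Set M} {p : Set (L.Formula (M ⊕ Fin m))} {κ : Cardinal.{w}}

/-- The sets in the definition of a randomness pattern are realized. -/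
lemma IsMonster.exists_realizes_pattern (hM : IsMonster L M θ) (hA : #A < θ)
    (hp : ∀ φ ∈ p, FormulaOver A φ) {J : Type w} (hJ : #J < θ) {n : J → ℕ}
    {b : ∀ j, ℕ → Fin (n j) → M} {φ : ∀ j, L.Formula (Fin m ⊕ Fin (n j))} {η : J → ℕ}
    (h : Consistent (p ∪ {ψ | ∃ j, ψ = plug (φ j) (b j (η j))} ∪
      {ψ | ∃ j i, i ≠ η j ∧ ψ = ∼(plug (φ j) (b j i))})) :
    ∃ c, Realizes p c ∧ ∀ j i, (φ j).Realize (Sum.elim c (b j i)) ↔ i = η j := by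
  classical
  have hO := mk_union_range_lt hM.aleph0_lt hA hJ
    fun x : Σ j, ℕ × Fin (n j) => b x.1 x.2.1 x.2.2
  have hdef : ∀ j i, DefinableOver L
      (A ∪ Set.range fun x : Σ j, ℕ × Fin (n j) => b x.1 x.2.1 x.2.2)
      {c | Sat (plug (φ j) (b j i)) c} := fun j i => by
    simp only [sat_plug]
    exact (definableOver_realize A (φ j)).fiber Set.subset_union_left
      fun l => Or.inr ⟨⟨j, i, l⟩, rfl⟩
  obtain ⟨c, hc⟩ := hM.exists_mem hO (fun ψ : (p ∪ {ψ | ∃ j, ψ = plug (φ j) (b j (η j))} ∪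
      {ψ | ∃ j i, i ≠ η j ∧ ψ = ∼(plug (φ j) (b j i))} : Set _) => {c | Sat ψ.1 c}) (by
    rintro ⟨ψ, (hψ | ⟨j, rfl⟩) | ⟨j, i, -, rfl⟩⟩
    · exact (hp ψ hψ).definableOver.mono Set.subset_union_left
    · exact hdef j _
    · simp only [sat_not]
      exact (hdef j i).compl) fun T => by
    obtain ⟨c, hc⟩ := h (Subtype.val '' (T : Set _)) (by rintro _ ⟨ψ, -, rfl⟩; exact ψ.2)
      (T.finite_toSet.image _)
    exact ⟨c, fun ψ hψ => hc _ ⟨ψ, hψ, rfl⟩⟩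
  refine ⟨c, fun ψ hψ => hc ⟨ψ, Or.inl (Or.inl hψ)⟩, fun j i => ?_⟩
  rw [← sat_plug]
  by_cases hi : i = η j
  · subst hi
    exact iff_of_true (hc ⟨_, Or.inl (Or.inr ⟨j, rfl⟩)⟩) rfl
  · exact iff_of_false (sat_not.1 (hc ⟨_, Or.inr ⟨j, i, hi, rfl⟩⟩)) hi

/-- The existence of a randomness pattern does not depend on the base set. -/
theorem HasRandomnessPattern.change_base [Nonempty M] (hM : IsMonster L M θ) (hB : #B < θ)
    (hp : ∀ φ ∈ p, FormulaOver B φ) (hκ : κ < θ) (h : HasRandomnessPattern A p κ) :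
    HasRandomnessPattern B p κ := by
  classical
  obtain ⟨J, n, b, φ, rfl, -, hη⟩ := h
  obtain ⟨m₀⟩ := ‹Nonempty M›
  obtain ⟨_, _⟩ := exists_wellFoundedLT J
  have hm₀ : #(B ∪ {m₀} : Set M) < θ := (Cardinal.mk_union_le _ _).trans_lt
    (Cardinal.add_lt_of_lt hM.aleph0_lt.le hB
      (by simpa using Cardinal.one_lt_aleph0.trans hM.aleph0_lt))
  -- The limit types are taken over the original tuples too, as the peeling arguments need, and over
  -- the padding element `m₀`.
  let C := B ∪ {m₀} ∪ Set.range fun x : Σ j, ℕ × Fin (n j) => b x.1 x.2.1 x.2.2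
  have hBC : B ⊆ C := fun x hx => Or.inl (Or.inl hx)
  have hb : ∀ j i l, b j i l ∈ C := fun j i l => Or.inr ⟨⟨j, i, l⟩, rfl⟩
  have hm₀C : m₀ ∈ C := Or.inl (Or.inr rfl)
  obtain ⟨b', hb'⟩ := hM.exists_isLimitFamily hκ (Filter.hyperfilter ℕ)
    (mk_union_range_lt hM.aleph0_lt hm₀ hκ _ : #C < θ) b
  refine ⟨J, n, b', φ, rfl, fun j => (hb'.mutuallyIndiscernible hb hm₀C j).mono
    (Set.union_subset_union_left _ hBC), fun η => ?_⟩
  let S : p ⊕ (J × ℕ) → Set ((Σ j, ℕ × Fin (n j)) ⊕ Fin m → M) :=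
    Sum.elim (fun ψ => {z | (fun i => z (Sum.inr i)) ∈ {c | Sat ψ.1 c}})
      (fun x => {z | (fun y => z (Sum.elim Sum.inr (fun l => Sum.inl ⟨x.1, x.2, l⟩) y)) ∈
        {d | d ∈ {d | (φ x.1).Realize d} ↔ x.2 = η x.1}})
  have hS : ∀ t, DefinableOver L B (S t) := by
    rintro (ψ | ⟨j, i⟩)
    · exact (hp _ ψ.2).definableOver.comp _
    · exact ((definableOver_realize B (φ j)).iff_prop _).comp _
  have aux : ∀ (y : (Σ j, ℕ × Fin (n j)) → M) (c : Fin m → M) (j : J) (i : ℕ),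
      Sum.elim y c ∈ S (Sum.inr (j, i)) ↔
        ((φ j).Realize (Sum.elim c fun l => y ⟨j, i, l⟩) ↔ i = η j) := by
    intro y c j i
    refine iff_of_eq (congrArg (fun z => ((φ j).Realize z ↔ i = η j)) ?_)
    ext (l | l) <;> rfl
  obtain ⟨c, hc⟩ := hM.exists_mem (mk_union_range_lt hM.aleph0_lt hB hκ
      fun x : Σ j, ℕ × Fin (n j) => b' x.1 x.2.1 x.2.2)
    (fun t : p ⊕ (J × ℕ) => {c | Sum.elim (fun x : Σ j, ℕ × Fin (n j) => b' x.1 x.2.1 x.2.2) c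
      ∈ S t}) (fun t => (hS t).preimage Set.subset_union_left _ (by
        rintro (x | i)
        · exact Or.inl ⟨_, Or.inr ⟨x, rfl⟩, fun _ => rfl⟩
        · exact Or.inr ⟨i, fun _ => rfl⟩)) (by
    intro T
    by_contra hne
    have hdef := (DefinableOver.biInter T fun t _ => hS t).image_inl
    -- If the conditions in `T` had no common solution for the limit tuples, the same would hold for
    -- suitable original tuples. The finite set includes the indices `(j, η j)` so that `f`
    -- separates them from the other relevant ones.
    obtain ⟨f, hf, hfX⟩ := hb'.exists_mem Filter.hyperfilter_le_cofinite hb hm₀C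
      (hdef.mono hBC).compl (fun ⟨c, hc⟩ => hne ⟨c, fun t ht => Set.mem_iInter₂.1 hc t ht⟩)
      (T.toRight ∪ T.toRight.image fun x => (x.1, η x.1))
    -- Injectivity of `f` turns the original pattern at `j ↦ f (j, η j)` into the required
    -- conditions at `η`.
    obtain ⟨c, hc, hcφ⟩ := hM.exists_realizes_pattern hB hp hκ (hη fun j => f (j, η j))
    refine hfX ⟨c, Set.mem_iInter₂.2 ?_⟩
    rintro (ψ | ⟨j, i⟩) ht
    · exact hc _ ψ.2
    · rw [aux]
      refine (hcφ j (f (j, i))).trans ⟨fun e => ?_, fun e => by rw [e]⟩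
      have hT : (j, i) ∈ T.toRight := Finset.mem_toRight.2 ht
      exact (Prod.mk.inj (hf (Finset.mem_coe.2 (Finset.mem_union_left _ hT))
        (Finset.mem_coe.2 (Finset.mem_union_right _ (Finset.mem_image_of_mem
          (fun x => (x.1, η x.1)) hT))) e)).2)
  have hcφ := fun j i => (aux _ c j i).1 (hc (Sum.inr (j, i)))
  refine consistent_of_realizes (c := c) ?_
  rintro χ ((hχ | ⟨j, rfl⟩) | ⟨j, i, hi, rfl⟩)
  · exact hc (Sum.inl ⟨χ, hχ⟩)
  · exact sat_plug.2 ((hcφ j _).2 rfl)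
  · rw [sat_not, sat_plug]
    exact fun h => hi ((hcφ j i).1 h)

end BaseChange

-- The equivalences with dp-rank

section Main

variable {L : FirstOrder.Language.{u, v}} {M : Type w} [L.Structure M] {θ : Cardinal.{w}}
  {m : ℕ} {A : Set M} {p : Set (L.Formula (M ⊕ Fin m))} {κ : Cardinal.{w}}

/-- A realization for `η = 0` satisfies `φ j` at member `0` and not at member `1`. The index order
is lifted to the universe of `M`. -/
lemma HasRandomnessPattern.hasSplitSequences (hM : IsMonster L M θ) (hA : #A < θ)
    (hp : ∀ φ ∈ p, FormulaOver A φ) (hκ : κ < θ) (h : HasRandomnessPattern A p κ) :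
    HasSplitSequences A p κ := by
  obtain ⟨J, n, b, φ, rfl, hb, hη⟩ := h
  obtain ⟨c, hc, hcφ⟩ := hM.exists_realizes_pattern hA hp hκ (hη fun _ => 0)
  refine ⟨J, ULift ℕ, inferInstance, n, fun j i => b j i.down, c, rfl, inferInstance, ?_, hc,
    fun j => ⟨⟨0⟩, ⟨1⟩, fun h => ?_⟩⟩
  · intro j r s t
    have hsub : (A ∪ {x | ∃ j', j' ≠ j ∧ ∃ (i : ULift.{w} ℕ) (l : Fin (n j')),
        b j' i.down l = x}) ⊆ A ∪ {x | ∃ j', j' ≠ j ∧ ∃ (i : ℕ) (l : Fin (n j')),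
        b j' i l = x} := by
      rintro x (hx | ⟨j', hj', i, l, rfl⟩)
      · exact Or.inl hx
      · exact Or.inr ⟨j', hj', i.down, l, rfl⟩
    have hdown : ∀ s : Fin r ↪o ULift.{w} ℕ, StrictMono fun q => (s q).down :=
      fun s _ _ h => s.strictMono h
    exact ((hb j).mono hsub) r (OrderEmbedding.ofStrictMono _ (hdown s))
      (OrderEmbedding.ofStrictMono _ (hdown t))
  · have := tp_eq_iff.1 h _ ((definableOver_realize (A ∪ Set.range c)
      ((φ j).relabel Sum.swap)).preimage subset_rfl (fun y => Sum.elim y c) (by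
        rintro (l | i)
        · exact Or.inr ⟨l, fun _ => rfl⟩
        · exact Or.inl ⟨c i, Or.inr ⟨i, rfl⟩, fun _ => rfl⟩))
    simp only [Set.mem_ofPred_eq, Formula.realize_relabel, Sum.elim_swap, hcφ] at this
    simp at this

lemma not_indiscernibleOver_of_tp_ne {I : Type*} [LinearOrder I] {n : ℕ} {a : I → Fin n → M}
    {i₁ i₂ : I} (h : tp L A (a i₁) ≠ tp L A (a i₂)) : ¬ IndiscernibleOver L A a := by
  intro hi
  refine h (tp_eq_iff.2 fun X hX => ?_)
  have := hi.mem_iff (V := Unit) (F := fun _ => i₁) (G := fun _ => i₂)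
    (fun _ _ => by simp) (hX.comp fun l => ((), l))
  exact this

lemma HasSplitSequences.not_dpRankLE (h : HasSplitSequences A p (1 + κ)) : ¬ DpRankLE A p κ := by
  obtain ⟨J, I, _, n, a, c, hJ, _, ha, hc, hsplit⟩ := h
  intro hle
  obtain ⟨j, hj⟩ := hle c hc J hJ (fun _ => I) n a ha
  obtain ⟨i₁, i₂, h⟩ := hsplit j
  exact not_indiscernibleOver_of_tp_ne h hj

variable [Nonempty M]

lemma HasSplitSequences.hasRandomnessPattern (hM : IsMonster L M θ) (hA : #A < θ)
    (hp : ∀ φ ∈ p, FormulaOver A φ) (hκ : κ < θ) (h : HasSplitSequences A p κ) :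
    HasRandomnessPattern A p κ := by
  obtain ⟨J, I, _, n, a, c, rfl, _, ha, hc, hsplit⟩ := h
  refine hasRandomnessPattern_of_not_indiscernibleOver hM hA hp hκ ha hc fun j => ?_
  obtain ⟨i₁, i₂, h⟩ := hsplit j
  exact not_indiscernibleOver_of_tp_ne h

/-- This describes the rank by patterns, for which the base can be changed; the failure of the bound
supplies exactly the sequences from which a pattern is extracted. -/
theorem not_dpRankLE_iff_hasRandomnessPattern (hM : IsMonster L M θ) (hA : #A < θ)
    (hp : ∀ φ ∈ p, FormulaOver A φ) (hκ : κ < θ) :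
    ¬ DpRankLE A p κ ↔ HasRandomnessPattern A p (1 + κ) := by
  have hκ' : 1 + κ < θ := Cardinal.add_lt_of_lt hM.aleph0_lt.le
    (Cardinal.one_lt_aleph0.trans hM.aleph0_lt) hκ
  refine ⟨fun h => ?_, fun h => (h.hasSplitSequences hM hA hp hκ').not_dpRankLE⟩
  simp only [DpRankLE, not_forall, not_exists] at h
  obtain ⟨c, hc, J, hJ, I, _, _, n, a, ha, hne⟩ := h
  rw [← hJ]
  exact hasRandomnessPattern_of_not_indiscernibleOver hM hA hp (hJ ▸ hκ') ha hc hne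

end Main

end DpRank

theorem mainTheorem5 {L : FirstOrder.Language.{u, v}} {M : Type w} [L.Structure M] [Nonempty M]
    (θ : Cardinal.{w}) (hM : DpRank.IsMonster L M θ) (m : ℕ) :
    (∀ (A : Set M) (p : Set (L.Formula (M ⊕ Fin m))), #A < θ → DpRank.IsCompleteType A p →
      (∀ κ < θ, DpRank.HasRandomnessPattern A p κ ↔ DpRank.HasSplitSequences A p κ) ∧
      (∀ κ < θ, List.TFAE [
        DpRank.HasRandomnessPattern A p (1 + κ),
        ¬ DpRank.DpRankLE A p κ,
        DpRank.HasSplitSequences A p (1 + κ)]) ∧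
      (∀ κ < θ, ℵ₀ ≤ κ → List.TFAE [
        DpRank.HasRandomnessPattern A p κ,
        ¬ DpRank.DpRankLE A p κ,
        DpRank.HasSplitSequences A p κ])) ∧
    (∀ (A B : Set M) (p : Set (L.Formula (M ⊕ Fin m))), #A < θ → #B < θ →
      DpRank.IsPartialType A p → DpRank.IsPartialType B p →
      ∀ μ < θ, (DpRank.DpRankLE A p μ ↔ DpRank.DpRankLE B p μ) ∧
        (DpRank.HasDpRank A p μ ↔ DpRank.HasDpRank B p μ)) := by
  refine ⟨fun A p hA hp => ?_, fun A B p hA hB hpA hpB => ?_⟩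
  · have hp' := hp.formulaOver
    have hRS : ∀ κ < θ, DpRank.HasRandomnessPattern A p κ ↔ DpRank.HasSplitSequences A p κ :=
      fun κ hκ => ⟨fun h => h.hasSplitSequences hM hA hp' hκ,
        fun h => h.hasRandomnessPattern hM hA hp' hκ⟩
    have hTFAE : ∀ κ < θ, List.TFAE [DpRank.HasRandomnessPattern A p (1 + κ),
        ¬ DpRank.DpRankLE A p κ, DpRank.HasSplitSequences A p (1 + κ)] := by
      intro κ hκ
      tfae_have 2 ↔ 1 := DpRank.not_dpRankLE_iff_hasRandomnessPattern hM hA hp' hκ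
      tfae_have 1 ↔ 3 := hRS _ (Cardinal.add_lt_of_lt hM.aleph0_lt.le
        (Cardinal.one_lt_aleph0.trans hM.aleph0_lt) hκ)
      tfae_finish
    refine ⟨hRS, hTFAE, fun κ hκ hω => ?_⟩
    have := hTFAE κ hκ
    rwa [Cardinal.add_eq_right hω (Cardinal.one_le_aleph0.trans hω)] at this
  · have key : ∀ μ < θ, DpRank.DpRankLE A p μ ↔ DpRank.DpRankLE B p μ := by
      intro μ hμ
      have hμ' : 1 + μ < θ := Cardinal.add_lt_of_lt hM.aleph0_lt.le
        (Cardinal.one_lt_aleph0.trans hM.aleph0_lt) hμ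
      rw [← not_iff_not,
        DpRank.not_dpRankLE_iff_hasRandomnessPattern hM hA hpA.formulaOver hμ,
        DpRank.not_dpRankLE_iff_hasRandomnessPattern hM hB hpB.formulaOver hμ]
      exact ⟨fun h => h.change_base hM hB hpB.formulaOver hμ',
        fun h => h.change_base hM hA hpA.formulaOver hμ'⟩
    exact fun μ hμ => ⟨key μ hμ, and_congr (key μ hμ)
      (forall₂_congr fun ν hν => not_congr (key ν (hν.trans hμ)))⟩
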